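/- **Setting.** Let $\Sigma$ be a finite alphabet, $\mathcal D$ an infinite set of data values, $M$ a finite monoid. A data word is a finite word $w=(a_1,d_1)\cdots(a_n,d_n)\in(\Sigma\times\mathcal D)^*$; $\mathrm{str}(w)=a_1\cdots a_n$; $i\sim j$ means $d_i=d_j$; $i\oplus1=j$ means that $j$ is the least position $>i$ with $j\sim i$. For a language $L$, the guarded predicate $\widetilde L(x,y)$ says that $x\sim y$, $x<y$ and the factor strictly between $x$ and $y$ is in $L$. For a morphism $h:\Sigma^*\to M$, $\mathrm{EMSO}^2[\Sigma,<,+1,\sim,\oplus1,\widetilde{\mathcal F}_h]$ consists of the closed formulas $\psi=\exists X_1\cdots\exists X_n\,\varphi$, where $\varphi$ is a first-order formula with only the two variables $x,y$, built from the letters of $\Sigma$, $X_1,\dots,X_n$, $=$, $<$, $+1$, $\sim$, $\oplus1$ and predicates $\widetilde L$ with $L=h^{-1}(P)$, $P\subseteq M$. $L(\psi)$ is the set of data words satisfying $\psi$. A *set automaton* $\mathcal A=(Q,Y,\Sigma,\Delta,I,F,C)$ has finite sets $Q$ of states and $Y$ of set names, transitions $(p,\ell,z,\rho,u,v,p')$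 with $p,p'\in Q$, $\ell\in\Sigma$, $z,u,v\in\{0,1\}^Y$ and $\rho\subseteq Y\times Y$, $I,F\subseteq Q$ and $C\subseteq\{0,1\}^Y$. A configuration is a state with a family $(X_y)_{y\in Y}$ of subsets of $\mathcal D$; initially the state is in $I$ and all $X_y$ are empty. In state $p$ on input $(\ell,d)$, the transition applies if $z$ is the membership vector of $d$; the state becomes $p'$ and $X_y$ becomes $\bigl(\bigcup_{(x,y)\in\rho}X_x\cup\{d\mid u_y=1\}\bigr)\setminus\{d\mid v_y=1\}$. A configuration is accepting if its state is in $F$ and the membership vector of every $d\in\bigcup_yX_y$ is in $C$. $L(\mathcal A)$ is the set of data words having a run from an initial to an accepting configuration. $\mathcal A$ is *normal* if in every transition $\rho$ is a function $Y\to Y$, $u$ is a unit vector, and $v=\rho(z)$ if $u\ne\rho(z)$, $v=0$ otherwise (where $\rho(z)$ is the vector of the image under $\rho$ of the set given by $z$). A name $y$ is *stable* if $\rho(y)=\{y\}=\rho^{-1}(y)$ for all updates $\rho$ occurring in $\Delta$. $\mathcal A$ is *quasi-normal* with a designated family $S\subseteq Y$ of stable names if all $y\in S$ are stable and the restriction of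 $\mathcal A$ to the names in $Y\setminus S$ is normal. It is *$h$-suffix-storing* if, for some such $S$, the remaining names are indexed bijectively as $Y\setminus S=\{X_m\mid m\in M\}$ and, whenever a configuration with $X_m\neq\emptyset$ is reached from an initial one by reading $w$, $m=h(s)$ for some (possibly empty) suffix $s$ of $\mathrm{str}(w)$. **Proposition.** 1. For every morphism $h:\Sigma^*\to M$ and every $\psi\in\mathrm{EMSO}^2[\Sigma,<,+1,\sim,\oplus1,\widetilde{\mathcal F}_h]$ there is an $h$-suffix-storing (quasi-normal) set automaton $\mathcal A_\psi$ over $\Sigma$ with $L(\mathcal A_\psi)=L(\psi)$. 2. More generally, let the guarded predicates also read the set variables: let $h:(\Sigma\times2^{\{X_1,\dots,X_n\}})^*\to M$ and $\psi=\exists X_1\cdots\exists X_n\,\varphi$ closed, as above, but with predicates $\widetilde L$, $L=h^{-1}(P)$, evaluated on the word over $\Sigma\times2^{\{X_1,\dots,X_n\}}$ given by $w$ and the interpretation of the $X_i$. Then there is an $h$-suffix-storing set automaton $\mathcal A_\varphi$ over $\Sigma\times2^{\{X_1,\dots,X_n\}}$ accepting exactly the data words that, read as a data word over $\Sigma$ with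 an interpretation of $X_1,\dots,X_n$, satisfy $\varphi$; and the automaton over $\Sigma$ obtained by projecting the letters of its transitions to $\Sigma$ is quasi-normal and accepts $L(\psi)$. -/

import Mathlib

universe u v

/-! ### Data words -/

/-- A data word over the alphabet `A` and the data domain `D` (the empty data word is included). -/
abbrev DataWord (A : Type u) (D : Type v) := List (A × D)

/-- The string projection of a data word. -/
def DataWord.str {A : Type u} {D : Type v} (w : DataWord A D) : List A := w.map Prod.fst

/-- The letter at a position. -/
def DataWord.label {A : Type u} {D : Type v} (w : DataWord A D) (i : Fin w.length) : A :=
  (w.get i).1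

/-- The data value at a position. -/
def DataWord.datum {A : Type u} {D : Type v} (w : DataWord A D) (i : Fin w.length) : D :=
  (w.get i).2

/-- `j` is the class successor of `i`: the next position carrying the data value of `i`. -/
def DataWord.ClassSucc {A : Type u} {D : Type v} (w : DataWord A D) (i j : Fin w.length) : Prop :=
  i < j ∧ w.datum i = w.datum j ∧ ∀ k, i < k → k < j → w.datum k ≠ w.datum i

/-- The data word over `A × 2^n` that records, at each position, the letter of `w` and the
indices `k` of the sets `X k` that contain the position. -/
def DataWord.decorate {A : Type u} {D : Type v} {n : ℕ} (w : DataWord A D)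
    (X : Fin n → Set (Fin w.length)) : DataWord (A × Set (Fin n)) D :=
  List.ofFn fun i => ((w.label i, {k | i ∈ X k}), w.datum i)

/-- The family of all languages recognised by the morphism `h`, i.e. those of the form
`h⁻¹(P)` with `P ⊆ M`. -/
def recognizedFamily {B : Type u} {M : Type v} [Monoid M] (h : FreeMonoid B →* M) :
    Set (Language B) :=
  {L | ∃ P : Set M, L = {s : List B | h (FreeMonoid.ofList s) ∈ P}}

/-! ### Two-variable logic with guarded regular predicates -/

/-- Formulas of `FO²[A, X₁, …, Xₙ, <, +1, ∼, ⊕1, F~]` where `F` is a family of languages. The two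
first-order variables are `0` and `1`; both may be requantified. -/
inductive FO2 (A : Type u) (n : ℕ) {B : Type v} (F : Set (Language B)) : Type (max u v)
  | letter (a : A) (x : Fin 2) : FO2 A n F
  | mem (k : Fin n) (x : Fin 2) : FO2 A n F
  | eq (x y : Fin 2) : FO2 A n F
  | lt (x y : Fin 2) : FO2 A n F
  | succ (x y : Fin 2) : FO2 A n F
  | sim (x y : Fin 2) : FO2 A n F
  | classSucc (x y : Fin 2) : FO2 A n F
  | guarded (L : F) (x y : Fin 2) : FO2 A n F
  | neg (φ : FO2 A n F) : FO2 A n F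
  | and (φ ψ : FO2 A n F) : FO2 A n F
  | or (φ ψ : FO2 A n F) : FO2 A n F
  | all (x : Fin 2) (φ : FO2 A n F) : FO2 A n F
  | ex (x : Fin 2) (φ : FO2 A n F) : FO2 A n F

namespace FO2

variable {A : Type u} {n : ℕ} {B : Type v} {F : Set (Language B)}

/-- The free first-order variables of a formula. -/
def freeVars : FO2 A n F → Set (Fin 2)
  | letter _ x => {x}
  | mem _ x => {x}
  | eq x y => {x, y}
  | lt x y => {x, y}
  | succ x y => {x, y}
  | sim x y => {x, y}
  | classSucc x y => {x, y}
  | guarded _ x y => {x, y}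
  | neg φ => φ.freeVars
  | and φ ψ => φ.freeVars ∪ ψ.freeVars
  | or φ ψ => φ.freeVars ∪ ψ.freeVars
  | all x φ => φ.freeVars \ {x}
  | ex x φ => φ.freeVars \ {x}

/-- A sentence is a formula without free first-order variables. -/
def IsSentence (φ : FO2 A n F) : Prop := φ.freeVars = ∅

/-- Satisfaction in the data word `w`, with `X` interpreting the set variables and `σ` a partial
assignment of positions to the first-order variables (partial, so that sentences can be evaluated
on the empty data word). The string `s`, of the same length as `w`, is the one whose factors
are tested by the regular predicates. -/
def Sat {D : Type*} (w : DataWord A D) (X : Fin n → Set (Fin w.length)) (s : List B) :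
    (Fin 2 → Option (Fin w.length)) → FO2 A n F → Prop
  | σ, letter a x => ∃ i, σ x = some i ∧ w.label i = a
  | σ, mem k x => ∃ i, σ x = some i ∧ i ∈ X k
  | σ, eq x y => ∃ i j, σ x = some i ∧ σ y = some j ∧ i = j
  | σ, lt x y => ∃ i j, σ x = some i ∧ σ y = some j ∧ i < j
  | σ, succ x y => ∃ i j, σ x = some i ∧ σ y = some j ∧ (i : ℕ) + 1 = j
  | σ, sim x y => ∃ i j, σ x = some i ∧ σ y = some j ∧ w.datum i = w.datum j
  | σ, classSucc x y => ∃ i j, σ x = some i ∧ σ y = some j ∧ w.ClassSucc i j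
  | σ, guarded L x y => ∃ i j, σ x = some i ∧ σ y = some j ∧ w.datum i = w.datum j ∧ i < j ∧
      (s.take (j : ℕ)).drop ((i : ℕ) + 1) ∈ (L : Language B)
  | σ, neg φ => ¬ Sat w X s σ φ
  | σ, and φ ψ => Sat w X s σ φ ∧ Sat w X s σ ψ
  | σ, or φ ψ => Sat w X s σ φ ∨ Sat w X s σ ψ
  | σ, all x φ => ∀ i, Sat w X s (Function.update σ x (some i)) φ
  | σ, ex x φ => ∃ i, Sat w X s (Function.update σ x (some i)) φ

end FO2

/-- Closed formulas `∃ X₁ … ∃ Xₙ φ` of `EMSO²[A, <, +1, ∼, ⊕1, F~]`, where `F` is a family of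
languages over the alphabet `A`. -/
structure EMSO2 (A : Type u) (F : Set (Language A)) where
  /-- the number of set variables -/
  n : ℕ
  matrix : FO2 A n F
  closed : matrix.IsSentence

/-- The data language of a closed `EMSO²` formula. -/
def EMSO2.language {A : Type u} {F : Set (Language A)} (D : Type v) (ψ : EMSO2 A F) :
    Set (DataWord A D) :=
  {w | ∃ X : Fin ψ.n → Set (Fin w.length), ψ.matrix.Sat w X w.str fun _ => none}

/-- Closed formulas `∃ X₁ … ∃ Xₙ φ` as before, except that the regular predicates of `φ` may also
depend on the set variables: `F` is a family of languages over the alphabet `A × 2^n`. -/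
structure ExtEMSO2 (A : Type u) (n : ℕ) (F : Set (Language (A × Set (Fin n)))) where
  matrix : FO2 A n F
  closed : matrix.IsSentence

/-- The data language over `A` of `∃ X₁ … ∃ Xₙ φ`. -/
def ExtEMSO2.language {A : Type u} {n : ℕ} {F : Set (Language (A × Set (Fin n)))} (D : Type v)
    (ψ : ExtEMSO2 A n F) : Set (DataWord A D) :=
  {w | ∃ X : Fin n → Set (Fin w.length), ψ.matrix.Sat w X (w.decorate X).str fun _ => none}

/-- The data language over `A × 2^n` of the first-order matrix `φ`, where the interpretation of
`X₁, …, Xₙ` is part of the data word. -/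
def ExtEMSO2.matrixLanguage {A : Type u} {n : ℕ} {F : Set (Language (A × Set (Fin n)))}
    (D : Type v) (ψ : ExtEMSO2 A n F) : Set (DataWord (A × Set (Fin n)) D) :=
  {w' | ∃ (w : DataWord A D) (X : Fin n → Set (Fin w.length)),
    w' = w.decorate X ∧ ψ.matrix.Sat w X (w.decorate X).str fun _ => none}

/-! ### Set automata

Boolean vectors indexed by `Y` are identified with subsets of `Y`. -/

/-- The vector `M(ρ)ᵀ · z`, i.e. the image of the set `z` under the relation `ρ`. -/
def updateVec {Y : Type*} (ρ : Y → Y → Prop) (z : Set Y) : Set Y := {y | ∃ x ∈ z, ρ x y}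

/-- The characteristic vector of the data value `d` in the family of sets `X`. -/
def charVec {Y D : Type*} (X : Y → Set D) (d : D) : Set Y := {y | d ∈ X y}

/-- A transition `(p, ℓ, z, ρ, u, v, p')`. -/
structure SetTransition (A : Type u) (Q Y : Type) where
  src : Q
  letter : A
  test : Set Y
  update : Y → Y → Prop
  add : Set Y
  remove : Set Y
  tgt : Q

/-- A set automaton `(Q, Y, A, Δ, I, F, C)`. -/
structure SetAutomaton (A : Type u) where
  State : Type
  Name : Type
  [finiteState : Finite State]
  [finiteName : Finite Name]
  trans : Set (SetTransition A State Name)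
  init : Set State
  final : Set State
  acc : Set (Set Name)

namespace SetAutomaton

variable {A : Type u}

/-- A configuration: a state and the contents of the sets. -/
structure Config (𝒜 : SetAutomaton A) (D : Type v) where
  state : 𝒜.State
  sets : 𝒜.Name → Set D

/-- One step on the input pair `(a, d)`: test the characteristic vector of `d`, apply the global
update, and then add `d` to, and remove `d` from, the sets given by the local updates. -/
def Step (𝒜 : SetAutomaton A) {D : Type v} (c : 𝒜.Config D) (p : A × D) (c' : 𝒜.Config D) : Prop :=
  ∃ t ∈ 𝒜.trans, t.src = c.state ∧ t.letter = p.1 ∧ t.test = charVec c.sets p.2 ∧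
    t.tgt = c'.state ∧
    ∀ y, c'.sets y =
      ((⋃ x ∈ {x | t.update x y}, c.sets x) ∪ {e | e = p.2 ∧ y ∈ t.add}) \
        {e | e = p.2 ∧ y ∈ t.remove}

/-- `𝒜.Reaches w c`: some run of `𝒜` on `w` leads from an initial configuration to `c`. -/
inductive Reaches (𝒜 : SetAutomaton A) {D : Type v} : DataWord A D → 𝒜.Config D → Prop
  | nil (q : 𝒜.State) (hq : q ∈ 𝒜.init) : Reaches 𝒜 [] ⟨q, fun _ => ∅⟩
  | snoc (w : DataWord A D) (c c' : 𝒜.Config D) (p : A × D) (hc : Reaches 𝒜 w c)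
      (hs : 𝒜.Step c p c') : Reaches 𝒜 (w ++ [p]) c'

/-- A configuration is accepting if its state is final and the characteristic vector of every
data value present in it is in `C`. -/
def Accepting (𝒜 : SetAutomaton A) {D : Type v} (c : 𝒜.Config D) : Prop :=
  c.state ∈ 𝒜.final ∧ ∀ d, (∃ y, d ∈ c.sets y) → charVec c.sets d ∈ 𝒜.acc

/-- The language of a set automaton. -/
def language (D : Type v) (𝒜 : SetAutomaton A) : Set (DataWord A D) :=
  {w | ∃ c, 𝒜.Reaches w c ∧ 𝒜.Accepting c}

/-- Letter-to-letter renaming: every transition on `a` becomes a transition on `f a`. -/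
def rename {A' : Type v} (𝒜 : SetAutomaton A) (f : A → A') : SetAutomaton A' where
  State := 𝒜.State
  Name := 𝒜.Name
  finiteState := 𝒜.finiteState
  finiteName := 𝒜.finiteName
  trans := (fun t => ⟨t.src, f t.letter, t.test, t.update, t.add, t.remove, t.tgt⟩) '' 𝒜.trans
  init := 𝒜.init
  final := 𝒜.final
  acc := 𝒜.acc

/-- A set automaton is normal if, in each of its transitions, the global update is a
transformation, `u` is a unit vector, and `v = M(ρ)ᵀ z` if `u ≠ M(ρ)ᵀ z` and `v = 0` otherwise. -/
def IsNormal (𝒜 : SetAutomaton A) : Prop :=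
  ∀ t ∈ 𝒜.trans, (∀ x, ∃! y, t.update x y) ∧ (∃ y, t.add = {y}) ∧
    (t.add ≠ updateVec t.update t.test → t.remove = updateVec t.update t.test) ∧
    (t.add = updateVec t.update t.test → t.remove = ∅)

/-- The restriction of a set automaton to the sets in `T`. -/
def restrict (𝒜 : SetAutomaton A) (T : Set 𝒜.Name) : SetAutomaton A where
  State := 𝒜.State
  Name := T
  finiteState := 𝒜.finiteState
  finiteName := by
    have := 𝒜.finiteName
    infer_instance
  trans := (fun t => ⟨t.src, t.letter, {y | (y : 𝒜.Name) ∈ t.test}, fun x y => t.update x y,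
    {y | (y : 𝒜.Name) ∈ t.add}, {y | (y : 𝒜.Name) ∈ t.remove}, t.tgt⟩) '' 𝒜.trans
  init := 𝒜.init
  final := 𝒜.final
  acc := (fun z => {y : T | (y : 𝒜.Name) ∈ z}) '' 𝒜.acc

/-- The set `y` is stable: `ρ(y) = {y} = ρ⁻¹(y)` for every global update `ρ` that is used. -/
def IsStable (𝒜 : SetAutomaton A) (y : 𝒜.Name) : Prop :=
  ∀ t ∈ 𝒜.trans, {x | t.update y x} = {y} ∧ {x | t.update x y} = {y}

/-- `𝒜` is quasi-normal with the family `S` of stable sets: every set in `S` is stable and the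
restriction of `𝒜` to the remaining sets is normal. -/
def IsQuasiNormalWith (𝒜 : SetAutomaton A) (S : Set 𝒜.Name) : Prop :=
  (∀ y ∈ S, 𝒜.IsStable y) ∧ (𝒜.restrict Sᶜ).IsNormal

/-- A set automaton is quasi-normal if it is so with some family of stable sets. -/
def IsQuasiNormal (𝒜 : SetAutomaton A) : Prop := ∃ S, 𝒜.IsQuasiNormalWith S

/-- `𝒜` is `h`-suffix-storing: it is quasi-normal with a family `S` of stable sets, the other sets
are indexed by `M` as `{X_m | m ∈ M}`, and whenever `X_m` is nonempty after reading `w`, the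
element `m` is the image under `h` of a suffix of the string projection of `w`. -/
def IsSuffixStoring (D : Type*) {M : Type*} [Monoid M] (h : FreeMonoid A →* M)
    (𝒜 : SetAutomaton A) : Prop :=
  ∃ S : Set 𝒜.Name, 𝒜.IsQuasiNormalWith S ∧
    ∃ X : M ≃ (Sᶜ : Set 𝒜.Name),
      ∀ (w : DataWord A D) (c : 𝒜.Config D), 𝒜.Reaches w c →
        ∀ m, (c.sets (X m)).Nonempty → ∃ s, s <:+ w.str ∧ h (FreeMonoid.ofList s) = m

end SetAutomaton

/-! With two variables a formula never relates a position to more than one other at a time. Whether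
`∃ y φ(x, y)` holds at `p` thus depends only on the label of `p` and on the set of pairs (relation
of `p` to `y`, label of `y`), the view of `p`. The relation ranges over a finite set: order,
adjacency and, inside a class, class succession and the value in `M` of the factor in between.
Passing from labels to views once per quantifier turns a formula into a condition on finitely many
labels (`FO2.typeDefinable`).

The point is that views are `Tileable`: a finite annotation can be guessed that is checked by local
constraints, on single positions, neighbours, class successors and the ends of the word and of the
classes, and that determines the view. By reversal only smaller positions matter. Those in the class
of `p` are collected by recursion along the class. For the other classes it suffices to know which
labels have occurred, and which in two different classes (`ClassWord.exists_not_sim_iff`). The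
obstacle is the immediate predecessor: no constraint compares horizontal with vertical neighbours
directly, so whether it lies in the same class is guessed and checked through an alternating
colouring (`Tileable.predSim`).

A set automaton verifies local constraints (`TileSys.mem_automaton_language_iff`). The state holds
the previous annotation. Each datum is stored in one stable set, for the annotation of its last
position, and in one set `X_m`, where `m` is the value of the suffix read since then. Upon the next
occurrence of the datum, `m` is exactly the factor between class successors, and such suffix values
are all that the sets `X_m` ever hold. -/

/-! ### Abstract class words and tile systems -/

/-- A finite linear order of positions with an equivalence relation (carrying the same datum), the
value in `M` of every position, and the value in `M` of the factor strictly between two positions. -/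
structure ClassWord (M : Type) [Monoid M] where
  Pos : Type
  [order : LinearOrder Pos]
  [finite : Finite Pos]
  sim : Setoid Pos
  val : Pos → M
  fac : Pos → Pos → M
  fac_mul : ∀ {i j k : Pos}, i < j → j < k → fac i k = fac i j * val j * fac j k

attribute [instance] ClassWord.order ClassWord.finite

namespace ClassWord

variable {M : Type} [Monoid M]

/-- `q` is the next position after `p` in the class of `p`. -/
def CSucc (S : ClassWord M) (p q : S.Pos) : Prop :=
  p < q ∧ S.sim p q ∧ ∀ k, p < k → k < q → ¬ S.sim k p

/-- The reversed class word. -/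
def dual (S : ClassWord M) : ClassWord Mᵐᵒᵖ where
  Pos := S.Posᵒᵈ
  sim := S.sim
  val p := MulOpposite.op (S.val (OrderDual.ofDual p))
  fac p q := MulOpposite.op (S.fac (OrderDual.ofDual q) (OrderDual.ofDual p))
  fac_mul {i j k} hij hjk := by
    have := S.fac_mul (i := OrderDual.ofDual k) (j := OrderDual.ofDual j)
      (k := OrderDual.ofDual i) hjk hij
    rw [this, MulOpposite.op_mul, MulOpposite.op_mul, mul_assoc]

theorem dual_cSucc (S : ClassWord M) (p q : S.Pos) :
    S.dual.CSucc (OrderDual.toDual p) (OrderDual.toDual q) ↔ S.CSucc q p := by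
  constructor
  · rintro ⟨h, hs, hk⟩
    have hs' : S.sim p q := hs
    exact ⟨h, S.sim.symm hs', fun k h1 h2 h3 =>
      hk (OrderDual.toDual k) h2 h1 (S.sim.trans h3 (S.sim.symm hs'))⟩
  · rintro ⟨h, hs, hk⟩
    exact ⟨h, S.sim.symm hs, fun k h1 h2 h3 => hk k h2 h1 (S.sim.trans h3 (S.sim.symm hs))⟩

theorem CSucc.unique {S : ClassWord M} {p p' q : S.Pos} (h : S.CSucc p q) (h' : S.CSucc p' q) :
    p = p' := by
  rcases lt_trichotomy p p' with hlt | rfl | hlt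
  · exact absurd (S.sim.trans h'.2.1 (S.sim.symm h.2.1)) (h.2.2 _ hlt h'.1)
  · rfl
  · exact absurd (S.sim.trans h.2.1 (S.sim.symm h'.2.1)) (h'.2.2 _ hlt h.1)

theorem exists_cSucc {S : ClassWord M} {p q : S.Pos} (h : q < p) (hs : S.sim q p) :
    ∃ r, S.CSucc r p := by
  obtain ⟨r, ⟨hr, hrs⟩, hmax⟩ := Set.Finite.exists_maximal
    (s := {r | r < p ∧ S.sim r p}) (Set.toFinite _) ⟨q, h, hs⟩
  refine ⟨r, hr, hrs, fun k h1 h2 h3 => ?_⟩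
  exact absurd (hmax ⟨h2, S.sim.trans h3 hrs⟩ h1.le) (not_le.2 h1)

theorem cSucc_of_covBy {S : ClassWord M} {p q : S.Pos} (h : q ⋖ p) (hs : S.sim q p) :
    S.CSucc q p :=
  ⟨h.1, hs, fun _ h1 h2 => absurd h2 (h.2 h1)⟩

end ClassWord

/-- Local constraints on annotations of the positions of a class word by elements of `N`. -/
structure TileSys (M N : Type) where
  /-- constrains the annotation of a position in terms of its value -/
  unary : M → N → Prop
  /-- constrains the annotations of consecutive positions -/
  horiz : N → N → Prop
  /-- constrains the annotations of class successors, given the factor in between -/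
  vert : N → M → N → Prop
  first : N → Prop
  last : N → Prop
  classFirst : N → Prop
  classLast : N → Prop

/-- An annotation satisfies all constraints. -/
structure TileSys.Valid {M N : Type} [Monoid M] (T : TileSys M N) (S : ClassWord M)
    (ν : S.Pos → N) : Prop where
  unary : ∀ p, T.unary (S.val p) (ν p)
  horiz : ∀ p q, p ⋖ q → T.horiz (ν p) (ν q)
  vert : ∀ p q, S.CSucc p q → T.vert (ν p) (S.fac p q) (ν q)
  first : ∀ p, (∀ q, ¬ q < p) → T.first (ν p)
  last : ∀ p, (∀ q, ¬ p < q) → T.last (ν p)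
  classFirst : ∀ p, (∀ q, q < p → ¬ S.sim q p) → T.classFirst (ν p)
  classLast : ∀ p, (∀ q, p < q → ¬ S.sim p q) → T.classLast (ν p)

/-- Conjunction of two tile systems, with a unary constraint linking the annotations. -/
def TileSys.prod {M N N' : Type} (T : TileSys M N) (T' : TileSys M N') (R : N → N' → Prop) :
    TileSys M (N × N') where
  unary m n := T.unary m n.1 ∧ T'.unary m n.2 ∧ R n.1 n.2
  horiz a b := T.horiz a.1 b.1 ∧ T'.horiz a.2 b.2
  vert a m b := T.vert a.1 m b.1 ∧ T'.vert a.2 m b.2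
  first a := T.first a.1 ∧ T'.first a.2
  last a := T.last a.1 ∧ T'.last a.2
  classFirst a := T.classFirst a.1 ∧ T'.classFirst a.2
  classLast a := T.classLast a.1 ∧ T'.classLast a.2

theorem TileSys.prod_valid {M N N' : Type} [Monoid M] (T : TileSys M N) (T' : TileSys M N')
    (R : N → N' → Prop) (S : ClassWord M) (ν : S.Pos → N × N') :
    (T.prod T' R).Valid S ν ↔ T.Valid S (fun p => (ν p).1) ∧ T'.Valid S (fun p => (ν p).2) ∧
      ∀ p, R (ν p).1 (ν p).2 := by
  constructor
  · rintro ⟨h1, h2, h3, h4, h5, h6, h7⟩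
    exact ⟨⟨fun p => (h1 p).1, fun p q h => (h2 p q h).1, fun p q h => (h3 p q h).1,
      fun p h => (h4 p h).1, fun p h => (h5 p h).1, fun p h => (h6 p h).1, fun p h => (h7 p h).1⟩,
      ⟨fun p => (h1 p).2.1, fun p q h => (h2 p q h).2, fun p q h => (h3 p q h).2,
      fun p h => (h4 p h).2, fun p h => (h5 p h).2, fun p h => (h6 p h).2, fun p h => (h7 p h).2⟩,
      fun p => (h1 p).2.2⟩
  · rintro ⟨⟨h1, h2, h3, h4, h5, h6, h7⟩, ⟨k1, k2, k3, k4, k5, k6, k7⟩, hR⟩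
    exact ⟨fun p => ⟨h1 p, k1 p, hR p⟩, fun p q h => ⟨h2 p q h, k2 p q h⟩,
      fun p q h => ⟨h3 p q h, k3 p q h⟩, fun p h => ⟨h4 p h, k4 p h⟩, fun p h => ⟨h5 p h, k5 p h⟩,
      fun p h => ⟨h6 p h, k6 p h⟩, fun p h => ⟨h7 p h, k7 p h⟩⟩

/-- The tile system without constraints. -/
def TileSys.free (M N : Type) : TileSys M N where
  unary _ _ := True
  horiz _ _ := True
  vert _ _ _ := True
  first _ := True
  last _ := True
  classFirst _ := True
  classLast _ := True

theorem TileSys.free_valid {M N : Type} [Monoid M] (S : ClassWord M) (ν : S.Pos → N) :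
    (TileSys.free M N).Valid S ν := by
  constructor <;> intros <;> trivial

/-- The reversed constraints. -/
def TileSys.dual {M N : Type} (T : TileSys Mᵐᵒᵖ N) : TileSys M N where
  unary m n := T.unary (MulOpposite.op m) n
  horiz a b := T.horiz b a
  vert a m b := T.vert b (MulOpposite.op m) a
  first := T.last
  last := T.first
  classFirst := T.classLast
  classLast := T.classFirst

theorem TileSys.dual_valid {M N : Type} [Monoid M] (T : TileSys Mᵐᵒᵖ N) (S : ClassWord M)
    (ν : S.Pos → N) : T.dual.Valid S ν ↔ T.Valid S.dual fun p => ν (OrderDual.ofDual p) := by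
  constructor
  · rintro ⟨h1, h2, h3, h4, h5, h6, h7⟩
    exact ⟨h1, fun p q h => h2 _ _ (toDual_covBy_toDual_iff.1 h),
      fun p q h => h3 _ _ ((S.dual_cSucc _ _).1 h), h5, h4,
      fun p h => h7 _ fun q hq hs => h q hq (S.sim.symm hs),
      fun p h => h6 _ fun q hq hs => h q hq (S.sim.symm hs)⟩
  · rintro ⟨h1, h2, h3, h4, h5, h6, h7⟩
    exact ⟨h1, fun p q h => h2 _ _ (toDual_covBy_toDual_iff.2 h),
      fun p q h => h3 _ _ ((S.dual_cSucc _ _).2 h), h5, h4,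
      fun p h => h7 p fun q hq hs => h q hq (S.sim.symm hs),
      fun p h => h6 p fun q hq hs => h q hq (S.sim.symm hs)⟩

/-- Maps that relabel class words. -/
abbrev Annot (M : Type) [Monoid M] (Γ Δ : Type) : Type 1 :=
  ∀ S : ClassWord M, (S.Pos → Γ) → S.Pos → Δ

/-- A relabelling is tileable if it is computed by a finite tile system: every labelling extends to
a valid annotation, and every valid annotation determines the new labels. -/
def Tileable {M : Type} [Monoid M] {Γ Δ : Type} (f : Annot M Γ Δ) : Prop :=
  ∃ (N : Type) (_ : Finite N) (T : TileSys M N) (i : N → Γ) (o : N → Δ),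
    (∀ (S : ClassWord M) (l : S.Pos → Γ), ∃ ν, T.Valid S ν ∧ ∀ p, i (ν p) = l p) ∧
    ∀ (S : ClassWord M) (ν : S.Pos → N), T.Valid S ν →
      ∀ p, o (ν p) = f S (fun q => i (ν q)) p

/-! ### Closure properties of tileable relabellings. -/

namespace Tileable

variable {M : Type} [Monoid M] {Γ Δ Δ' : Type}

theorem id [Finite Γ] : Tileable (M := M) (fun _ l p => l p : Annot M Γ Γ) :=
  ⟨Γ, inferInstance, TileSys.free M Γ, fun g => g, fun g => g,
    fun S l => ⟨l, TileSys.free_valid S l, fun _ => rfl⟩, fun _ _ _ _ => rfl⟩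

theorem map {f : Annot M Γ Δ} (hf : Tileable f) (φ : Δ → Δ') :
    Tileable (fun S l p => φ (f S l p)) := by
  obtain ⟨N, hN, T, i, o, h1, h2⟩ := hf
  exact ⟨N, hN, T, i, fun n => φ (o n), h1, fun S ν hν p => congrArg φ (h2 S ν hν p)⟩

theorem val [Finite M] [Finite Γ] : Tileable (fun S _ p => S.val p : Annot M Γ M) := by
  refine ⟨Γ × M, inferInstance, { TileSys.free M (Γ × M) with unary := fun m n => m = n.2 },
    Prod.fst, Prod.snd, fun S l => ⟨fun p => (l p, S.val p), ?_, fun _ => rfl⟩,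
    fun S ν hν p => (hν.unary p).symm⟩
  constructor <;> intros <;> trivial

/-- The two annotations are guessed together, the output of the first being matched position by
position with the input of the second. This works because valid annotations determine the output, so
no wrong intermediate labelling can be passed on. -/
theorem comp {f : Annot M Γ Δ} (hf : Tileable f) {g : Annot M Δ Δ'} (hg : Tileable g) :
    Tileable (fun S l => g S (f S l)) := by
  obtain ⟨N, hN, T, i, o, h1, h2⟩ := hf
  obtain ⟨N', hN', T', i', o', h1', h2'⟩ := hg
  refine ⟨N × N', inferInstance, T.prod T' (fun n n' => i' n' = o n), fun n => i n.1,
    fun n => o' n.2, fun S l => ?_, fun S ν hν p => ?_⟩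
  · obtain ⟨ν, hν, hi⟩ := h1 S l
    obtain ⟨ν', hν', hi'⟩ := h1' S (fun p => o (ν p))
    exact ⟨fun p => (ν p, ν' p), (TileSys.prod_valid _ _ _ _ _).2 ⟨hν, hν', hi'⟩, hi⟩
  · obtain ⟨hν, hν', hR⟩ := (TileSys.prod_valid _ _ _ _ _).1 hν
    refine (h2' S _ hν' p).trans ?_
    congr 1
    funext q
    rw [hR, h2 S _ hν q]

theorem pair {f : Annot M Γ Δ} (hf : Tileable f) {g : Annot M Γ Δ'} (hg : Tileable g) :
    Tileable (fun S l p => (f S l p, g S l p)) := by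
  obtain ⟨N, hN, T, i, o, h1, h2⟩ := hf
  obtain ⟨N', hN', T', i', o', h1', h2'⟩ := hg
  refine ⟨N × N', inferInstance, T.prod T' (fun n n' => i' n' = i n), fun n => i n.1,
    fun n => (o n.1, o' n.2), fun S l => ?_, fun S ν hν p => ?_⟩
  · obtain ⟨ν, hν, hi⟩ := h1 S l
    obtain ⟨ν', hν', hi'⟩ := h1' S l
    exact ⟨fun p => (ν p, ν' p),
      (TileSys.prod_valid _ _ _ _ _).2 ⟨hν, hν', fun p => (hi' p).trans (hi p).symm⟩, hi⟩
  · obtain ⟨hν, hν', hR⟩ := (TileSys.prod_valid _ _ _ _ _).1 hν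
    refine Prod.ext (h2 S _ hν p) ((h2' S _ hν' p).trans ?_)
    simp only [hR]

/-- Tile constraints have no preferred direction, unlike recursion. This yields information about
larger positions from constructions that only look back. -/
theorem dual {f : Annot Mᵐᵒᵖ Γ Δ} (hf : Tileable f) :
    Tileable (M := M) (fun S l p => f S.dual (fun q => l (OrderDual.ofDual q)) (OrderDual.toDual p)) := by
  obtain ⟨N, hN, T, i, o, h1, h2⟩ := hf
  refine ⟨N, hN, T.dual, i, o, fun S l => ?_, fun S ν hν p => ?_⟩
  · obtain ⟨ν, hν, hi⟩ := h1 S.dual (fun q => l (OrderDual.ofDual q))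
    exact ⟨fun p => ν (OrderDual.toDual p), (T.dual_valid S _).2 hν, hi⟩
  · exact h2 S.dual _ ((T.dual_valid S ν).1 hν) (OrderDual.toDual p)

/-- A relabelling that is defined by recursion along the positions is tileable. -/
theorem scan [Finite Δ] {a : Annot M Γ Δ'} (ha : Tileable a) (f : Annot M Γ Δ) (δ : Δ)
    (step : Δ' → Δ → Δ) (h0 : ∀ S l p, (∀ q, ¬ q < p) → f S l p = δ)
    (hs : ∀ S l p q, q ⋖ p → f S l p = step (a S l q) (f S l q)) : Tileable f := by
  obtain ⟨N, hN, T, i, o, h1, h2⟩ := ha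
  refine ⟨N × Δ, inferInstance,
    { T.prod (TileSys.free M Δ) (fun _ _ => True) with
      horiz := fun n n' => T.horiz n.1 n'.1 ∧ n'.2 = step (o n.1) n.2
      first := fun n => T.first n.1 ∧ n.2 = δ }, fun n => i n.1, Prod.snd,
    fun S l => ?_, fun S ν hν => ?_⟩
  · obtain ⟨ν, hν, hi⟩ := h1 S l
    refine ⟨fun p => (ν p, f S l p), ?_, hi⟩
    have hi' : (fun p => i (ν p)) = l := funext hi
    refine ⟨fun p => ⟨hν.unary p, trivial, trivial⟩, fun p q h => ⟨hν.horiz p q h, ?_⟩,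
      fun p q h => ⟨hν.vert p q h, trivial⟩, fun p h => ⟨hν.first p h, h0 S l p h⟩,
      fun p h => ⟨hν.last p h, trivial⟩, fun p h => ⟨hν.classFirst p h, trivial⟩,
      fun p h => ⟨hν.classLast p h, trivial⟩⟩
    rw [h2 S ν hν p, hi']
    exact hs S l q p h
  · have hν' : T.Valid S (fun p => (ν p).1) := ⟨fun p => (hν.unary p).1,
      fun p q h => (hν.horiz p q h).1, fun p q h => (hν.vert p q h).1,
      fun p h => (hν.first p h).1, fun p h => (hν.last p h).1, fun p h => (hν.classFirst p h).1,
      fun p h => (hν.classLast p h).1⟩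
    -- The horizontal constraint propagates the forced value at the first position, so the guessed
    -- component agrees with `f` everywhere.
    intro p
    induction p using WellFoundedLT.induction with
    | ind p ih =>
      by_cases hp : ∀ q, ¬ q < p
      · rw [h0 S _ p hp]
        exact (hν.first p hp).2
      · have : ∃ q, q ⋖ p := by
          push Not at hp
          obtain ⟨q, hq⟩ := hp
          obtain ⟨r, -, hr⟩ := exists_le_covBy_of_lt hq
          exact ⟨r, hr⟩
        obtain ⟨q, hq⟩ := this
        rw [hs S _ p q hq, ← ih q hq.1, ← h2 S _ hν' q]
        exact (hν.horiz q p hq).2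

/-- A relabelling that is defined by recursion along the classes is tileable. -/
theorem classScan [Finite Δ] {a : Annot M Γ Δ'} (ha : Tileable a) (f : Annot M Γ Δ) (δ : Δ)
    (step : Δ' → Δ → M → Δ) (h0 : ∀ S l p, (∀ q, q < p → ¬ S.sim q p) → f S l p = δ)
    (hs : ∀ S l p q, S.CSucc q p → f S l p = step (a S l q) (f S l q) (S.fac q p)) :
    Tileable f := by
  obtain ⟨N, hN, T, i, o, h1, h2⟩ := ha
  refine ⟨N × Δ, inferInstance,
    { T.prod (TileSys.free M Δ) (fun _ _ => True) with
      vert := fun n m n' => T.vert n.1 m n'.1 ∧ n'.2 = step (o n.1) n.2 m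
      classFirst := fun n => T.classFirst n.1 ∧ n.2 = δ }, fun n => i n.1, Prod.snd,
    fun S l => ?_, fun S ν hν => ?_⟩
  · obtain ⟨ν, hν, hi⟩ := h1 S l
    refine ⟨fun p => (ν p, f S l p), ?_, hi⟩
    have hi' : (fun p => i (ν p)) = l := funext hi
    refine ⟨fun p => ⟨hν.unary p, trivial, trivial⟩, fun p q h => ⟨hν.horiz p q h, trivial⟩,
      fun p q h => ⟨hν.vert p q h, ?_⟩, fun p h => ⟨hν.first p h, trivial⟩,
      fun p h => ⟨hν.last p h, trivial⟩, fun p h => ⟨hν.classFirst p h, h0 S l p h⟩,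
      fun p h => ⟨hν.classLast p h, trivial⟩⟩
    rw [h2 S ν hν p, hi']
    exact hs S l q p h
  · have hν' : T.Valid S (fun p => (ν p).1) := ⟨fun p => (hν.unary p).1,
      fun p q h => (hν.horiz p q h).1, fun p q h => (hν.vert p q h).1,
      fun p h => (hν.first p h).1, fun p h => (hν.last p h).1, fun p h => (hν.classFirst p h).1,
      fun p h => (hν.classLast p h).1⟩
    intro p
    induction p using WellFoundedLT.induction with
    | ind p ih =>
      by_cases hp : ∀ q, q < p → ¬ S.sim q p
      · rw [h0 S _ p hp]
        exact (hν.classFirst p hp).2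
      · push Not at hp
        obtain ⟨q', hq', hqs⟩ := hp
        obtain ⟨q, hq⟩ := ClassWord.exists_cSucc hq' hqs
        rw [hs S _ p q hq, ← ih q hq.1, ← h2 S _ hν' q]
        exact (hν.vert q p hq).2

/-- The new labels of the predecessor. -/
theorem prev [Finite Δ] {f : Annot M Γ Δ} (hf : Tileable f) :
    Tileable (fun S l p => {d | ∃ q, q ⋖ p ∧ f S l q = d}) := by
  refine scan hf _ ∅ (fun d _ => {d}) (fun S l p hp => ?_) fun S l p q hq => ?_
  · ext d
    simp only [Set.mem_ofPred_eq, Set.mem_empty_iff_false, iff_false]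
    rintro ⟨q, hq, -⟩
    exact hp q hq.1
  · ext d
    simp only [Set.mem_ofPred_eq, Set.mem_singleton_iff]
    constructor
    · rintro ⟨q', hq', rfl⟩
      rw [hq.unique_left hq']
    · rintro rfl
      exact ⟨q, hq, rfl⟩

end Tileable

/-- If every element has at most one parent, and parents are smaller, there is a two-colouring of
the forest. -/
theorem exists_alternating {P : Type} [LinearOrder P] [Finite P] (R : P → P → Prop)
    (hlt : ∀ q v, R q v → q < v) (huniq : ∀ q q' v, R q v → R q' v → q = q') :
    ∃ D : P → Prop, ∀ q v, R q v → (D v ↔ ¬ D q) := by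
  have wf : WellFounded ((· < ·) : P → P → Prop) := wellFounded_lt
  refine ⟨wf.fix fun v rec => ∀ q (h : q < v), R q v → ¬ rec q h, fun q v h => ?_⟩
  conv_lhs => rw [wf.fix_eq]
  exact ⟨fun H => H q (hlt q v h) h, fun H q' _ hq' => huniq _ _ _ h hq' ▸ H⟩

/-- Whether the predecessor of a position lies in its class can be guessed and verified. -/
theorem Tileable.predSim {M : Type} [Monoid M] {Γ : Type} [Finite Γ] :
    Tileable (fun S _ p => ∃ q, q ⋖ p ∧ S.sim q p : Annot M Γ Prop) := by
  -- Besides its label, a position carries its own colour and the sets of colours of its predecessor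
  -- and of its class predecessor, each a singleton or empty. The colour `none` claims that the
  -- successor lies in the same class; the other two colours claim that it does not. The unary
  -- constraint demands that a predecessor coloured `none` be matched by a class predecessor
  -- coloured `none`, and that otherwise the two colours differ.
  refine ⟨Γ × Option Prop × Set (Option Prop) × Set (Option Prop), inferInstance,
    { TileSys.free M _ with
      unary := fun _ n => ∀ c ∈ n.2.2.1, (c = none → none ∈ n.2.2.2) ∧ (c ≠ none → c ∉ n.2.2.2)
      horiz := fun n n' => n'.2.2.1 = {n.2.1}
      vert := fun n _ n' => n'.2.2.2 = {n.2.1}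
      first := fun n => n.2.2.1 = ∅
      classFirst := fun n => n.2.2.2 = ∅ }, Prod.fst, fun n => none ∈ n.2.2.1,
    fun S l => ?_, fun S ν hν p => ?_⟩
  -- If the predecessor `v` of `x` is not its class predecessor `q`, then `v` and `q` need different
  -- colours. As `v` determines `x`, hence `q`, and `q < v`, these requirements form a forest.
  · obtain ⟨D, hD⟩ := exists_alternating
      (fun q v : S.Pos => q < v ∧ ∃ x, v ⋖ x ∧ S.CSucc q x) (fun q v h => h.1)
      (fun q q' v h h' => by
        obtain ⟨-, x, hx, hq⟩ := h
        obtain ⟨-, x', hx', hq'⟩ := h'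
        obtain rfl := hx.unique_right hx'
        exact hq.unique hq')
    classical
    let c : S.Pos → Option Prop := fun p => if ∃ q, p ⋖ q ∧ S.sim p q then none else some (D p)
    refine ⟨fun p => (l p, c p, {d | ∃ q, q ⋖ p ∧ c q = d}, {d | ∃ q, S.CSucc q p ∧ c q = d}),
      ?_, fun _ => rfl⟩
    refine ⟨?_, ?_, ?_, fun _ h => ?_, fun _ _ => trivial, fun p h => ?_, fun _ _ => trivial⟩
    · rintro p _ ⟨q, hq, rfl⟩
      constructor
      · intro hc
        have hq' : ∃ r, q ⋖ r ∧ S.sim q r := by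
          by_contra hcon
          simp [c, hcon] at hc
        obtain ⟨r, hr, hrs⟩ := hq'
        obtain rfl := hr.unique_right hq
        exact ⟨q, ClassWord.cSucc_of_covBy hq hrs, hc⟩
      · rintro hc ⟨r, hr, hrc⟩
        have hq' : ¬ ∃ r, q ⋖ r ∧ S.sim q r := by
          intro hcon
          simp [c, hcon] at hc
        have hne : r ≠ q := by
          rintro rfl
          exact hq' ⟨p, hq, hr.2.1⟩
        have hlt : r < q := lt_of_le_of_ne (hq.le_of_lt hr.1) hne
        have hr' : ¬ ∃ x, r ⋖ x ∧ S.sim r x := by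
          rintro ⟨x, hx, hxs⟩
          exact hr.2.2 x hx.1 (lt_of_le_of_lt (hx.ge_of_gt hlt) hq.1) (S.sim.symm hxs)
        have := hD r q ⟨hlt, p, hq, hr⟩
        simp only [c, hq', hr', if_false, Option.some.injEq] at hrc
        rw [hrc] at this
        exact iff_not_self this
    · intro p q h
      ext d
      simp only [Set.mem_ofPred_eq, Set.mem_singleton_iff]
      constructor
      · rintro ⟨r, hr, rfl⟩
        rw [hr.unique_left h]
      · rintro rfl
        exact ⟨p, h, rfl⟩
    · intro p q h
      ext d
      simp only [Set.mem_ofPred_eq, Set.mem_singleton_iff]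
      constructor
      · rintro ⟨r, hr, rfl⟩
        rw [hr.unique h]
      · rintro rfl
        exact ⟨p, h, rfl⟩
    · ext d
      simp only [Set.mem_ofPred_eq, Set.mem_empty_iff_false, iff_false]
      rintro ⟨r, hr, rfl⟩
      exact h r hr.1
    · ext d
      simp only [Set.mem_ofPred_eq, Set.mem_empty_iff_false, iff_false]
      rintro ⟨r, hr, rfl⟩
      exact h r hr.1 hr.2.1
  · have key : ∀ q p, q ⋖ p → ((ν q).2.1 = none ↔ S.sim q p) := by
      intro q
      induction q using WellFoundedLT.induction with
      | ind q ih =>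
        intro p hq
        have hu := hν.unary p _ (show (ν q).2.1 ∈ (ν p).2.2.1 by
          rw [hν.horiz q p hq]; rfl)
        constructor
        · intro hc
          have h1 := hu.1 hc
          by_cases hp : ∃ r, S.CSucc r p
          · obtain ⟨r, hr⟩ := hp
            rw [hν.vert r p hr] at h1
            -- The class predecessor `r` of `p` is also coloured `none`. Were `r < q`, the induction
            -- hypothesis would put the successor of `r` into the class, strictly between `r` and
            -- `p`; so `r = q`.
            rcases (hq.le_of_lt hr.1).lt_or_eq with hlt | rfl
            · obtain ⟨x, hx, hxq⟩ := exists_covBy_le_of_lt hlt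
              have := (ih r hlt x hx).1 (Set.mem_singleton_iff.1 h1).symm
              exact absurd (S.sim.symm this) (hr.2.2 x hx.1 (lt_of_le_of_lt hxq hq.1))
            · exact hr.2.1
          · rw [hν.classFirst p fun r hr hs => hp (ClassWord.exists_cSucc hr hs)] at h1
            exact h1.elim
        -- Now `q` is both predecessor and class predecessor of `p`, so a colour other than `none`
        -- would clash with itself.
        · intro hs
          by_contra hc
          refine hu.2 hc ?_
          rw [hν.vert q p (ClassWord.cSucc_of_covBy hq hs)]
          rfl
    by_cases hp : ∃ q, q ⋖ p
    · obtain ⟨q, hq⟩ := hp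
      have h1 : (ν p).2.2.1 = {(ν q).2.1} := hν.horiz q p hq
      beta_reduce
      rw [h1, Set.mem_singleton_iff, eq_comm (a := none), key q p hq]
      refine propext ⟨fun h => ⟨q, hq, h⟩, ?_⟩
      rintro ⟨q', hq', h⟩
      rwa [hq.unique_left hq']
    · have h1 : (ν p).2.2.1 = ∅ := hν.first p fun q hq => hp (by
        obtain ⟨r, -, hr⟩ := exists_le_covBy_of_lt hq
        exact ⟨r, hr⟩)
      beta_reduce
      rw [h1]
      refine propext ⟨fun h => h.elim, ?_⟩
      rintro ⟨q, hq, -⟩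
      exact (hp ⟨q, hq⟩).elim

/-! ### Binary types and views -/

/-- The values describing a pair of distinct positions, smaller one first: whether they are
consecutive and, if they are in the same class, whether they are class successors and the value of
the factor in between. -/
abbrev PRel (M : Type) : Type := Prop × Option (Prop × M)

namespace ClassWord

variable {M : Type} [Monoid M]

open Classical in
/-- The description of the pair of positions `y < p`. -/
noncomputable def rel (S : ClassWord M) (y p : S.Pos) : PRel M :=
  (y ⋖ p, if S.sim y p then some (S.CSucc y p, S.fac y p) else none)

open Classical in
/-- The description of an arbitrary pair of positions. -/
noncomputable def fullRel (S : ClassWord M) (x y : S.Pos) : Option (Bool × PRel M) :=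
  if x = y then none else if x < y then some (true, S.rel x y) else some (false, S.rel y x)

theorem fullRel_self (S : ClassWord M) (x : S.Pos) : S.fullRel x x = none := by
  simp [fullRel]

theorem fullRel_of_lt (S : ClassWord M) {x y : S.Pos} (h : x < y) :
    S.fullRel x y = some (true, S.rel x y) := by
  simp [fullRel, h, h.ne]

theorem fullRel_of_gt (S : ClassWord M) {x y : S.Pos} (h : y < x) :
    S.fullRel x y = some (false, S.rel y x) := by
  simp [fullRel, h.not_gt, h.ne']

/-- Translates a past view in the reversed word into information about larger positions in the
original word. -/
theorem rel_dual (S : ClassWord M) (p y : S.Pos) :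
    ((S.dual.rel (OrderDual.toDual y) (OrderDual.toDual p)).1,
      (S.dual.rel (OrderDual.toDual y) (OrderDual.toDual p)).2.map
        (Prod.map id MulOpposite.unop)) = S.rel p y := by
  have hcov : OrderDual.toDual y ⋖ OrderDual.toDual p ↔ p ⋖ y := toDual_covBy_toDual_iff
  refine Prod.ext (propext hcov) ?_
  have hsim : S.dual.sim (OrderDual.toDual y) (OrderDual.toDual p) ↔ S.sim p y :=
    ⟨fun h => S.sim.symm h, fun h => S.sim.symm h⟩
  by_cases h : S.sim p y
  · simp only [rel, h, hsim.2 h, if_true, Option.map_some, S.dual_cSucc]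
    rfl
  · simp only [rel, h, mt hsim.1 h, if_false, Option.map_none]

/-- The smaller positions together with their relation to `p`. -/
noncomputable def pastView {Γ : Type} (S : ClassWord M) (l : S.Pos → Γ) (p : S.Pos) :
    Set (PRel M × Γ) := {t | ∃ y, y < p ∧ S.rel y p = t.1 ∧ l y = t.2}

/-- All positions together with their relation to `p`. -/
noncomputable def view {Γ : Type} (S : ClassWord M) (l : S.Pos → Γ) (p : S.Pos) :
    Set (Option (Bool × PRel M) × Γ) := {t | ∃ y, S.fullRel p y = t.1 ∧ l y = t.2}

/-- The smaller positions in the class of `p`. -/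
def classPast {Γ : Type} (S : ClassWord M) (l : S.Pos → Γ) (p : S.Pos) :
    Set (Prop × M × Γ) :=
  {t | ∃ y, y < p ∧ S.sim y p ∧ (S.CSucc y p) = t.1 ∧ S.fac y p = t.2.1 ∧ l y = t.2.2}

/-- The labels occurring before `p`. -/
def seenOnce {Γ : Type} (S : ClassWord M) (l : S.Pos → Γ) (p : S.Pos) : Set Γ :=
  {g | ∃ y, y < p ∧ l y = g}

/-- The labels occurring before `p` in two classes. -/
def seenTwice {Γ : Type} (S : ClassWord M) (l : S.Pos → Γ) (p : S.Pos) : Set Γ :=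
  {g | ∃ y z, y < p ∧ z < p ∧ ¬ S.sim y z ∧ l y = g ∧ l z = g}

/-- Counting classes up to two is enough: a label seen in two classes occurs outside any given
class, and a label seen in only one occurs outside the class of `p` exactly when it does not occur
inside. -/
theorem exists_not_sim_iff {Γ : Type} (S : ClassWord M) (l : S.Pos → Γ) (p q : S.Pos) (g : Γ) :
    (∃ y, y < q ∧ ¬ S.sim y p ∧ l y = g) ↔
      g ∈ S.seenTwice l q ∨ g ∈ S.seenOnce l q ∧ ¬ ∃ y, y < q ∧ S.sim y p ∧ l y = g := by
  constructor
  · rintro ⟨y, hy, hs, rfl⟩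
    by_cases h : ∃ z, z < q ∧ S.sim z p ∧ l z = l y
    · obtain ⟨z, hz, hzs, hl⟩ := h
      exact Or.inl ⟨y, z, hy, hz, fun h => hs (S.sim.trans h hzs), rfl, hl⟩
    · exact Or.inr ⟨⟨y, hy, rfl⟩, h⟩
  · rintro (⟨y, z, hy, hz, hs, hly, hlz⟩ | ⟨⟨y, hy, hl⟩, h⟩)
    · by_cases h : S.sim y p
      · exact ⟨z, hz, fun h' => hs (S.sim.trans h (S.sim.symm h')), hlz⟩
      · exact ⟨y, hy, h, hly⟩
    · exact ⟨y, hy, fun hs => h ⟨y, hy, hs, hl⟩, hl⟩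

theorem exists_sim_iff {Γ : Type} (S : ClassWord M) (l : S.Pos → Γ) (p : S.Pos) (g : Γ) :
    (∃ y, y < p ∧ S.sim y p ∧ l y = g) ↔ ∃ c m, (c, m, g) ∈ S.classPast l p := by
  constructor
  · rintro ⟨y, hy, hs, hl⟩
    exact ⟨_, _, y, hy, hs, rfl, rfl, hl⟩
  · rintro ⟨c, m, y, hy, hs, -, -, hl⟩
    exact ⟨y, hy, hs, hl⟩

end ClassWord

/-! ### Tileability of views. -/

namespace Tileable

open ClassWord

variable {M : Type} [Monoid M] [Finite M] {Γ : Type} [Finite Γ]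

/-- The class past of `p` consists of its class predecessor `q` and of the class past of `q`, whose
factors are extended by the value of `q` and the factor from `q` to `p` (`fac_mul`). Only `q` itself
is flagged as class predecessor. -/
theorem classPast : Tileable (M := M) (Γ := Γ) (fun S l p => S.classPast l p) := by
  refine classScan (id.pair val) _ ∅
    (fun a s m => {t | t = (True, m, a.1) ∨ t.1 = False ∧
      ∃ c n, (c, n, t.2.2) ∈ s ∧ n * a.2 * m = t.2.1}) (fun S l p hp => ?_) fun S l p q hq => ?_
  · ext t
    simp only [Set.mem_empty_iff_false, iff_false]
    rintro ⟨y, hy, hs, -⟩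
    exact hp y hy hs
  · ext ⟨c, m, g⟩
    constructor
    · rintro ⟨y, hy, hs, hc, hm, hl⟩
      dsimp only at hc hm hl
      subst hc hm hl
      have hyq : y ≤ q := not_lt.1 fun h => hq.2.2 y h hy (S.sim.trans hs (S.sim.symm hq.2.1))
      rcases hyq.lt_or_eq with hlt | rfl
      · have hsq := S.sim.trans hs (S.sim.symm hq.2.1)
        refine Or.inr ⟨eq_false fun h => hlt.ne (h.unique hq), ?_⟩
        exact ⟨_, _, ⟨y, hlt, hsq, rfl, rfl, rfl⟩, (S.fac_mul hlt hq.1).symm⟩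
      · exact Or.inl (by simp [hq])
    · rintro (h | ⟨hc, c', n, ⟨y, hy, hs, -, hn, hl⟩, hm⟩)
      · simp only [Prod.mk.injEq] at h
        obtain ⟨rfl, rfl, rfl⟩ := h
        exact ⟨q, hq.1, hq.2.1, eq_true hq, rfl, rfl⟩
      · dsimp only at hc hn hl hm
        subst hc hn hl hm
        exact ⟨y, hy.trans hq.1, S.sim.trans hs hq.2.1, eq_false fun h => hy.ne (h.unique hq),
          S.fac_mul hy hq.1, rfl⟩

/-- Recursion along the positions: the label of `q` becomes seen twice when it has occurred before
`q` in another class. This is decided by `exists_not_sim_iff` from the sets at `q` and the class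
past of `q`. -/
theorem seen : Tileable (M := M) (Γ := Γ) (fun S l p => (S.seenOnce l p, S.seenTwice l p)) := by
  refine scan (id.pair classPast) _ (∅, ∅)
    (fun a s => ({g | g ∈ s.1 ∨ a.1 = g}, {g | g ∈ s.2 ∨ a.1 = g ∧
      (g ∈ s.2 ∨ g ∈ s.1 ∧ ¬ ∃ c m, (c, m, g) ∈ a.2)})) (fun S l p hp => ?_)
      fun S l p q hq => ?_
  · refine Prod.ext ?_ ?_
    · ext g
      simp only [Set.mem_empty_iff_false, iff_false]
      rintro ⟨y, hy, -⟩
      exact hp y hy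
    · ext g
      simp only [Set.mem_empty_iff_false, iff_false]
      rintro ⟨y, _, hy, -⟩
      exact hp y hy
  · have hlt : ∀ y, y < p ↔ y < q ∨ y = q := fun y =>
      ⟨fun h => (hq.le_of_lt h).lt_or_eq, fun h => h.elim (fun h => h.trans hq.1) fun h => h ▸ hq.1⟩
    refine Prod.ext ?_ ?_
    · ext g
      constructor
      · rintro ⟨y, hy, hl⟩
        rcases (hlt y).1 hy with h | rfl
        · exact Or.inl ⟨y, h, hl⟩
        · exact Or.inr hl
      · rintro (⟨y, hy, hl⟩ | hl)
        · exact ⟨y, hy.trans hq.1, hl⟩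
        · exact ⟨q, hq.1, hl⟩
    · ext g
      have key := S.exists_not_sim_iff l q q g
      rw [S.exists_sim_iff] at key
      constructor
      · rintro ⟨y, z, hy, hz, hs, hly, hlz⟩
        rcases (hlt y).1 hy with hy' | rfl
        · rcases (hlt z).1 hz with hz' | rfl
          · exact Or.inl ⟨y, z, hy', hz', hs, hly, hlz⟩
          · exact Or.inr ⟨hlz, key.1 ⟨y, hy', hs, hly⟩⟩
        · rcases (hlt z).1 hz with hz' | rfl
          · exact Or.inr ⟨hly, key.1 ⟨z, hz', fun h => hs (S.sim.symm h), hlz⟩⟩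
          · exact absurd (S.sim.refl _) hs
      · rintro (⟨y, z, hy, hz, h⟩ | ⟨hl, h⟩)
        · exact ⟨y, z, hy.trans hq.1, hz.trans hq.1, h⟩
        · obtain ⟨y, hy, hs, hly⟩ := key.2 h
          exact ⟨y, q, hy.trans hq.1, hq.1, hs, hly, hl⟩

/-- The labels of non-adjacent smaller positions in other classes. -/
theorem farPast : Tileable (M := M) (Γ := Γ)
    (fun S l p => {g | ∃ y q, y < q ∧ q ⋖ p ∧ ¬ S.sim y p ∧ l y = g}) := by
  have h1 : Tileable (M := M) (Γ := Γ) (fun S l p =>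
      ({s | ∃ q, q ⋖ p ∧ ((S.seenOnce l q, S.seenTwice l q), S.classPast l q) = s},
        S.classPast l p, (∃ q, q ⋖ p ∧ S.sim q p : Prop))) :=
    ((seen.pair classPast).prev).pair (classPast.pair predSim)
  refine (congrArg Tileable ?_).mp (h1.map (fun t => {g : Γ | ∃ s ∈ t.1, g ∈ s.1.2 ∨ g ∈ s.1.1 ∧
    ¬ ((t.2.2 ∧ ∃ c m, (c, m, g) ∈ s.2) ∨ (¬ t.2.2 ∧ ∃ c m, (c, m, g) ∈ t.2.1))}))
  funext S l p
  ext g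
  -- The positions of the class of `p` strictly before the predecessor `q` form the class past of
  -- `q` if `q` is in the class. Otherwise they form the whole class past of `p`.
  have key : ∀ q, q ⋖ p → ((∃ y, y < q ∧ S.sim y p ∧ l y = g) ↔
      (((∃ q, q ⋖ p ∧ S.sim q p) ∧ ∃ c m, (c, m, g) ∈ S.classPast l q) ∨
        (¬ (∃ q, q ⋖ p ∧ S.sim q p) ∧ ∃ c m, (c, m, g) ∈ S.classPast l p))) := by
    intro q hq
    by_cases h : ∃ q, q ⋖ p ∧ S.sim q p
    · have hqs : S.sim q p := by
        obtain ⟨q', hq', hs⟩ := h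
        rwa [hq.unique_left hq']
      simp only [h, true_and, not_true_eq_false, false_and, or_false]
      rw [← S.exists_sim_iff]
      exact ⟨fun ⟨y, hy, hs, hl⟩ => ⟨y, hy, S.sim.trans hs (S.sim.symm hqs), hl⟩,
        fun ⟨y, hy, hs, hl⟩ => ⟨y, hy, S.sim.trans hs hqs, hl⟩⟩
    · simp only [h, not_false_eq_true, true_and, false_and, false_or]
      rw [← S.exists_sim_iff]
      refine ⟨fun ⟨y, hy, hs, hl⟩ => ⟨y, hy.trans hq.1, hs, hl⟩, fun ⟨y, hy, hs, hl⟩ =>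
        ⟨y, lt_of_le_of_ne (hq.le_of_lt hy) ?_, hs, hl⟩⟩
      rintro rfl
      exact h ⟨y, hq, hs⟩
  constructor
  · rintro ⟨_, ⟨q, hq, rfl⟩, h⟩
    dsimp only at h
    rw [← key q hq] at h
    obtain ⟨y, hy, hs, hl⟩ := (S.exists_not_sim_iff l p q g).2 h
    exact ⟨y, q, hy, hq, hs, hl⟩
  · rintro ⟨y, q, hy, hq, hs, hl⟩
    refine ⟨_, ⟨q, hq, rfl⟩, ?_⟩
    dsimp only
    rw [← key q hq]
    exact (S.exists_not_sim_iff l p q g).1 ⟨y, hy, hs, hl⟩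

/-- A smaller position is the predecessor in another class, a farther position in another class, or
in the class of `p`. In the last case adjacency is no extra information: it holds just for the class
predecessor, and only if the predecessor lies in the class. -/
theorem pastView : Tileable (M := M) (Γ := Γ) (fun S l p => S.pastView l p) := by
  have h1 : Tileable (M := M) (Γ := Γ) (fun S l p =>
      ({g | ∃ q, q ⋖ p ∧ l q = g}, S.classPast l p, (∃ q, q ⋖ p ∧ S.sim q p : Prop),
        {g | ∃ y q, y < q ∧ q ⋖ p ∧ ¬ S.sim y p ∧ l y = g})) :=
    id.prev.pair (classPast.pair (predSim.pair farPast))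
  refine (congrArg Tileable ?_).mp (h1.map (fun t => {s : PRel M × Γ |
    (s.1.2 = none ∧ s.1.1 = True ∧ s.2 ∈ t.1 ∧ ¬ t.2.2.1) ∨
    (s.1.2 = none ∧ s.1.1 = False ∧ s.2 ∈ t.2.2.2) ∨
    ∃ c m, s.1.2 = some (c, m) ∧ (c, m, s.2) ∈ t.2.1 ∧ s.1.1 = (c ∧ t.2.2.1)}))
  funext S l p
  have hcov : ∀ y, S.sim y p → ((y ⋖ p) = (S.CSucc y p ∧ ∃ q, q ⋖ p ∧ S.sim q p)) := by
    refine fun y hs => propext ⟨fun h => ⟨cSucc_of_covBy h hs, y, h, hs⟩, ?_⟩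
    rintro ⟨hy, q, hq, hqs⟩
    rwa [hy.unique (cSucc_of_covBy hq hqs)]
  ext ⟨⟨a, o⟩, g⟩
  constructor
  · rintro (⟨ho, ha, ⟨q, hq, hl⟩, hns⟩ | ⟨ho, ha, y, q, hy, hq, hns, hl⟩ |
      ⟨c, m, ho, ⟨y, hy, hs, hc, hm, hl⟩, ha⟩)
    · have hns' : ¬ S.sim q p := fun h => hns ⟨q, hq, h⟩
      dsimp only at ho ha
      exact ⟨q, hq.1, by simp [ClassWord.rel, hq, hns', ho, ha], hl⟩
    · have hnc : ¬ y ⋖ p := fun h => h.2 hy hq.1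
      dsimp only at ho ha
      exact ⟨y, hy.trans hq.1, by simp [ClassWord.rel, hns, hnc, ho, ha], hl⟩
    · dsimp only at ho ha hc hm hl
      subst ho ha hc hm hl
      refine ⟨y, hy, ?_, rfl⟩
      rw [ClassWord.rel, if_pos hs, hcov y hs]
  · rintro ⟨y, hy, hr, hl⟩
    obtain ⟨rfl, rfl⟩ := Prod.mk.inj hr
    dsimp only at hl
    subst hl
    by_cases hs : S.sim y p
    · refine Or.inr (Or.inr ⟨S.CSucc y p, S.fac y p, if_pos hs, ⟨y, hy, hs, rfl, rfl, rfl⟩, ?_⟩)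
      exact hcov y hs
    · by_cases hc : y ⋖ p
      · refine Or.inl ⟨if_neg hs, eq_true hc, ⟨y, hc, rfl⟩, ?_⟩
        rintro ⟨q, hq, hqs⟩
        exact hs (by rwa [hc.unique_left hq])
      · obtain ⟨q, hyq, hq⟩ := exists_le_covBy_of_lt hy
        refine Or.inr (Or.inl ⟨if_neg hs, eq_false hc, y, q, lt_of_le_of_ne hyq ?_, hq, hs, rfl⟩)
        rintro rfl
        exact hc hq

theorem view : Tileable (M := M) (Γ := Γ) (fun S l p => S.view l p) := by
  have hfin : Finite Mᵐᵒᵖ := Finite.of_equiv M MulOpposite.opEquiv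
  have h1 : Tileable (M := M) (Γ := Γ) (fun S l p => (l p, S.pastView l p,
      S.dual.pastView (fun q => l (OrderDual.ofDual q)) (OrderDual.toDual p))) :=
    id.pair (pastView.pair (pastView (M := Mᵐᵒᵖ)).dual)
  refine (congrArg Tileable ?_).mp (h1.map (fun t => {s : Option (Bool × PRel M) × Γ |
    s = (none, t.1) ∨ (∃ r, s.1 = some (false, r) ∧ (r, s.2) ∈ t.2.1) ∨
    ∃ r : PRel Mᵐᵒᵖ, s.1 = some (true, (r.1, r.2.map (Prod.map _root_.id MulOpposite.unop))) ∧
      (r, s.2) ∈ t.2.2}))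
  funext S l p
  ext ⟨r, g⟩
  constructor
  · rintro (h | ⟨r, hr, y, hy, hry, hl⟩ | ⟨r, hr, y, hy, hry, hl⟩)
    · obtain ⟨rfl, rfl⟩ := Prod.mk.inj h
      exact ⟨p, S.fullRel_self p, rfl⟩
    · dsimp only at hr hry hl
      exact ⟨y, by rw [S.fullRel_of_gt hy, hr, hry], hl⟩
    · dsimp only at hr hry hl
      subst hry
      refine ⟨OrderDual.ofDual y,
        (S.fullRel_of_lt (show p < OrderDual.ofDual y from hy)).trans (Eq.trans ?_ hr.symm), hl⟩
      exact congrArg (fun t => some (true, t)) (S.rel_dual p (OrderDual.ofDual y)).symm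
  · rintro ⟨y, hr, hl⟩
    dsimp only at hr hl
    subst hr hl
    rcases lt_trichotomy p y with h | rfl | h
    · refine Or.inr (Or.inr ⟨_, ?_, OrderDual.toDual y, h, rfl, rfl⟩)
      dsimp only
      rw [S.fullRel_of_lt h]
      exact congrArg (fun t => some (true, t)) (S.rel_dual p y).symm
    · exact Or.inl (by rw [S.fullRel_self])
    · exact Or.inr (Or.inl ⟨_, S.fullRel_of_gt h, y, h, rfl, rfl⟩)

end Tileable

/-! ### Data words as class words, and definability -/

/-- The class word of a data word, given by its letters and its data values. -/
abbrev wordClass {B : Type u} {D : Type v} {M : Type} [Monoid M] (h : FreeMonoid B →* M) {L : ℕ}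
    (b : Fin L → B) (d : Fin L → D) : ClassWord M where
  Pos := Fin L
  sim := Setoid.ker d
  val i := h (FreeMonoid.of (b i))
  fac i j := h (FreeMonoid.ofList (((List.ofFn b).take j).drop (i + 1)))
  fac_mul {i j k} hij hjk := by
    have hij' : (i : ℕ) < j := hij
    have hjk' : (j : ℕ) < k := hjk
    have hsplit : ((List.ofFn b).take k).drop (i + 1) =
        ((List.ofFn b).take j).drop (i + 1) ++
          (b j :: ((List.ofFn b).take k).drop (j + 1)) := by
      have h1 : (List.ofFn b).take k =
          (List.ofFn b).take j ++ (b j :: ((List.ofFn b).take k).drop (j + 1)) := by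
        conv_lhs => rw [← List.take_append_drop j ((List.ofFn b).take k)]
        rw [List.take_take, min_eq_left hjk'.le, List.drop_eq_getElem_cons (by simp; omega)]
        simp
      conv_lhs => rw [h1]
      rw [List.drop_append_of_le_length (by simp; omega)]
    rw [hsplit, ← List.singleton_append]
    simp only [FreeMonoid.ofList_append, map_mul, mul_assoc]
    rfl

namespace ClassWord

variable {M : Type} [Monoid M] (S : ClassWord M) (x y : S.Pos)

theorem fullRel_eq_true_iff (Q : PRel M → Prop) :
    (∃ r, S.fullRel x y = some (true, r) ∧ Q r) ↔ x < y ∧ Q (S.rel x y) := by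
  rcases lt_trichotomy x y with hlt | rfl | hlt
  · rw [S.fullRel_of_lt hlt]
    simp [hlt]
  · rw [S.fullRel_self]
    simp
  · rw [S.fullRel_of_gt hlt]
    simp [hlt.not_gt]

theorem fullRel_eq_none_iff : S.fullRel x y = none ↔ x = y := by
  rcases lt_trichotomy x y with hlt | rfl | hlt
  · rw [S.fullRel_of_lt hlt]
    simp [hlt.ne]
  · rw [S.fullRel_self]
    simp
  · rw [S.fullRel_of_gt hlt]
    simp [hlt.ne']

theorem rel_eq_some_iff (Q : Prop → M → Prop) :
    (∃ c m, (S.rel x y).2 = some (c, m) ∧ Q c m) ↔ S.sim x y ∧ Q (S.CSucc x y) (S.fac x y) := by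
  by_cases hs : S.sim x y
  · rw [rel, if_pos hs]
    simp [hs, -eq_iff_iff]
  · simp [rel, hs]

theorem fullRel_sim_iff :
    (S.fullRel x y = none ∨ ∃ t, S.fullRel x y = some t ∧ t.2.2 ≠ none) ↔ S.sim x y := by
  rcases lt_trichotomy x y with hlt | rfl | hlt
  · rw [S.fullRel_of_lt hlt]
    simp [rel]
  · rw [S.fullRel_self]
    simp
  · rw [S.fullRel_of_gt hlt]
    simpa [rel] using ⟨fun h => S.sim.symm h, fun h => S.sim.symm h⟩

end ClassWord

/-! ### From formulas to tile systems. -/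

section Definability

variable {A : Type u} {D : Type v} {n : ℕ} {M Γ : Type} [Monoid M]
  (h : FreeMonoid (A × Set (Fin n)) →* M) (e : A × Set (Fin n) → Γ)

/-- The class word of a data word with interpreted set variables. -/
abbrev decoClass (w : DataWord A D) (X : Fin n → Set (Fin w.length)) : ClassWord M :=
  wordClass h (fun i => (w.label i, {k | i ∈ X k})) w.datum

/-- The base labelling of a data word with interpreted set variables. -/
abbrev decoLabel (w : DataWord A D) (X : Fin n → Set (Fin w.length)) (i : Fin w.length) : Γ :=
  e (w.label i, {k | i ∈ X k})

/-- A binary relation on positions is definable if it only depends on tileable labels of the two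
positions and on their mutual relation. -/
def TypeDefinable
    (R : ∀ (w : DataWord A D) (_ : Fin n → Set (Fin w.length)), (Fin 2 → Fin w.length) → Prop) :
    Prop :=
  ∃ (Δ : Type) (_ : Finite Δ) (f : Annot M Γ Δ)
    (Φ : (Fin 2 → Δ) → (Fin 2 → Fin 2 → Option (Bool × PRel M)) → Prop), Tileable f ∧
    ∀ w X σ, R w X σ ↔ Φ (fun i => f (decoClass h w X) (decoLabel e w X) (σ i))
      (fun i j => (decoClass h w X).fullRel (σ i) (σ j))

namespace TypeDefinable

variable {h e}
variable {R R' : ∀ (w : DataWord A D) (_ : Fin n → Set (Fin w.length)),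
  (Fin 2 → Fin w.length) → Prop}

theorem congr (hR : TypeDefinable h e R) (hRR : ∀ w X σ, R' w X σ ↔ R w X σ) :
    TypeDefinable h e R' := by
  obtain ⟨Δ, hΔ, f, Φ, hf, hΦ⟩ := hR
  exact ⟨Δ, hΔ, f, Φ, hf, fun w X σ => (hRR w X σ).trans (hΦ w X σ)⟩

theorem neg (hR : TypeDefinable h e R) : TypeDefinable h e fun w X σ => ¬ R w X σ := by
  obtain ⟨Δ, hΔ, f, Φ, hf, hΦ⟩ := hR
  exact ⟨Δ, hΔ, f, fun t r => ¬ Φ t r, hf, fun w X σ => not_congr (hΦ w X σ)⟩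

theorem and (hR : TypeDefinable h e R) (hR' : TypeDefinable h e R') :
    TypeDefinable h e fun w X σ => R w X σ ∧ R' w X σ := by
  obtain ⟨Δ, hΔ, f, Φ, hf, hΦ⟩ := hR
  obtain ⟨Δ', hΔ', f', Φ', hf', hΦ'⟩ := hR'
  exact ⟨Δ × Δ', inferInstance, _, fun t r => Φ (fun i => (t i).1) r ∧ Φ' (fun i => (t i).2) r,
    hf.pair hf', fun w X σ => and_congr (hΦ w X σ) (hΦ' w X σ)⟩

theorem label [Finite Γ] (P : Γ → Prop) (x : Fin 2) :
    TypeDefinable (D := D) h e fun w X σ => P (decoLabel e w X (σ x)) :=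
  ⟨Γ, inferInstance, _, fun t _ => P (t x), Tileable.id, fun _ _ _ => Iff.rfl⟩

theorem rel [Finite Γ] (P : Option (Bool × PRel M) → Prop) (x y : Fin 2) :
    TypeDefinable (D := D) h e fun w X σ => P ((decoClass h w X).fullRel (σ x) (σ y)) :=
  ⟨Γ, inferInstance, _, fun _ r => P (r x y), Tileable.id, fun _ _ _ => Iff.rfl⟩

/-- The relation of the pair of positions read in the opposite order. -/
def flipRel (r : Option (Bool × PRel M)) : Option (Bool × PRel M) := r.map fun t => (!t.1, t.2)

theorem fullRel_flip (S : ClassWord M) (x y : S.Pos) :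
    S.fullRel y x = flipRel (S.fullRel x y) := by
  rcases lt_trichotomy x y with h | rfl | h
  · rw [S.fullRel_of_lt h, S.fullRel_of_gt h]; rfl
  · rw [S.fullRel_self]; rfl
  · rw [S.fullRel_of_lt h, S.fullRel_of_gt h]; rfl

/-- A witness for the quantified variable matters only through its label and its relation to the
other variable. Both are listed in the view of the other variable, taken with respect to the labels
`f`, so adding this view to the labels eliminates the quantifier. -/
theorem ex [Finite M] (hR : TypeDefinable h e R) (x : Fin 2) :
    TypeDefinable h e fun w X σ => ∃ p, R w X (Function.update σ x p) := by
  obtain ⟨Δ, hΔ, f, Φ, hf, hΦ⟩ := hR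
  -- `x.rev` is the variable other than `x`. The table of relations is rebuilt from one entry:
  -- `none` on the diagonal, the entry from `x.rev` to `x`, and its flip.
  refine ⟨Δ × Set (Option (Bool × PRel M) × Δ), inferInstance, _,
    fun t _ => ∃ s ∈ (t x.rev).2, Φ (Function.update (fun i => (t i).1) x s.2)
      (fun i j => if i = j then none else if j = x then s.1 else flipRel s.1),
    hf.pair (hf.comp Tileable.view), fun w X σ => ?_⟩
  have hfin1 : ∀ x i j : Fin 2, i ≠ j → j = x → i = x.rev := by decide
  have hfin2 : ∀ x i j : Fin 2, i ≠ j → j ≠ x → i = x ∧ j = x.rev := by decide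
  have key : ∀ p, R w X (Function.update σ x p) ↔
      Φ (Function.update (fun i => f (decoClass h w X) (decoLabel e w X) (σ i)) x
        (f (decoClass h w X) (decoLabel e w X) p))
      (fun i j => if i = j then none else if j = x then
        (decoClass h w X).fullRel (σ x.rev) p else
          flipRel ((decoClass h w X).fullRel (σ x.rev) p)) := by
    intro p
    rw [hΦ]
    have h1 : (fun i => f (decoClass h w X) (decoLabel e w X) (Function.update σ x p i)) =
        Function.update (fun i => f (decoClass h w X) (decoLabel e w X) (σ i)) x
        (f (decoClass h w X) (decoLabel e w X) p) := by
      funext i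
      by_cases hi : i = x
      · subst hi; simp
      · simp [hi]
    have h2 : (fun i j => (decoClass h w X).fullRel (Function.update σ x p i)
          (Function.update σ x p j)) = (fun i j => if i = j then none else if j = x then
        (decoClass h w X).fullRel (σ x.rev) p else
          flipRel ((decoClass h w X).fullRel (σ x.rev) p)) := by
      funext i j
      by_cases hij : i = j
      · subst hij
        rw [if_pos rfl]
        exact ClassWord.fullRel_self _ _
      · rw [if_neg hij]
        by_cases hj : j = x
        · have hi : i = x.rev := hfin1 x i j hij hj
          have hi' : i ≠ x := fun h => hij (h.trans hj.symm)
          rw [if_pos hj, Function.update_of_ne hi', hj, Function.update_self, hi]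
        · obtain ⟨hi, hj'⟩ := hfin2 x i j hij hj
          rw [if_neg hj, Function.update_of_ne hj, hi, Function.update_self, hj']
          exact fullRel_flip _ _ _
    rw [h1]
    exact Iff.of_eq (congrArg _ h2)
  constructor
  · rintro ⟨p, hp⟩
    exact ⟨((decoClass h w X).fullRel (σ x.rev) p, f (decoClass h w X) (decoLabel e w X) p),
      ⟨p, rfl, rfl⟩, (key p).1 hp⟩
  · rintro ⟨⟨r, g⟩, ⟨p, hr, hg⟩, hp⟩
    dsimp only at hr hg
    subst hr hg
    exact ⟨p, (key p).2 hp⟩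

end TypeDefinable

theorem wordClass_covBy {B : Type u} (h : FreeMonoid B →* M) {L : ℕ}
    (b : Fin L → B) (d : Fin L → D) (p q : (wordClass h b d).Pos) :
    p ⋖ q ↔ ((show Fin L from p) : ℕ) + 1 = (show Fin L from q) := by
  change (show Fin L from p) ⋖ (show Fin L from q) ↔ _
  rw [Fin.covBy_iff, Nat.covBy_iff_add_one_eq]

variable {C : Type*} {F : Set (Language C)}

theorem FO2.sat_congr {w : DataWord A D} {X : Fin n → Set (Fin w.length)} {s : List C}
    (φ : FO2 A n F) {σ τ : Fin 2 → Option (Fin w.length)}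
    (hστ : ∀ x ∈ φ.freeVars, σ x = τ x) : φ.Sat w X s σ ↔ φ.Sat w X s τ := by
  induction φ generalizing σ τ with
  | letter a x => simp only [FO2.Sat, hστ x rfl]
  | mem k x => simp only [FO2.Sat, hστ x rfl]
  | eq x y | lt x y | succ x y | sim x y | classSucc x y =>
    simp only [FO2.Sat, hστ x (Or.inl rfl), hστ y (Or.inr rfl)]
  | guarded L x y => simp only [FO2.Sat, hστ x (Or.inl rfl), hστ y (Or.inr rfl)]
  | neg φ ih => exact not_congr (ih hστ)
  | and φ ψ ih ih' =>
    exact and_congr (ih fun x hx => hστ x (Or.inl hx)) (ih' fun x hx => hστ x (Or.inr hx))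
  | or φ ψ ih ih' =>
    exact or_congr (ih fun x hx => hστ x (Or.inl hx)) (ih' fun x hx => hστ x (Or.inr hx))
  | all x φ ih | ex x φ ih =>
    simp only [FO2.Sat]
    first
    | refine forall_congr' fun i => ih fun y hy => ?_
    | refine exists_congr fun i => ih fun y hy => ?_
    by_cases hxy : y = x
    · subst hxy; simp
    · simp only [Function.update_of_ne hxy]
      exact hστ y ⟨hy, hxy⟩

theorem update_some {L : ℕ} (σ : Fin 2 → Fin L) (x : Fin 2) (i : Fin L) :
    Function.update (fun y => some (σ y)) x (some i) =
      fun y => some (Function.update σ x i y) := by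
  funext y
  by_cases hy : y = x
  · subst hy; simp
  · simp [hy]

variable [Finite M] [Finite Γ]

theorem FO2.typeDefinable (he : Function.Injective e)
    (s : ∀ (w : DataWord A D) (_ : Fin n → Set (Fin w.length)), List C)
    (hF : ∀ L ∈ F, ∃ P : Set M, ∀ w X (i j : Fin w.length), i < j →
      (((s w X).take j).drop (i + 1) ∈ L ↔ (decoClass h w X).fac i j ∈ P))
    (φ : FO2 A n F) :
    TypeDefinable (D := D) h e fun w X σ => φ.Sat w X (s w X) fun x => some (σ x) := by
  induction φ with
  | letter a x =>
    refine (TypeDefinable.label (fun g => ∃ t, g = e t ∧ t.1 = a) x).congr fun w X σ => ?_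
    simp only [FO2.Sat, Option.some.injEq, exists_eq_left', he.eq_iff]
  | mem k x =>
    refine (TypeDefinable.label (fun g => ∃ t, g = e t ∧ k ∈ t.2) x).congr fun w X σ => ?_
    simp only [FO2.Sat, Option.some.injEq, exists_eq_left', he.eq_iff]
    rfl
  | eq x y =>
    refine (TypeDefinable.rel (fun r => r = none) x y).congr fun w X σ => ?_
    simp only [FO2.Sat, Option.some.injEq, exists_and_left, exists_eq_left']
    exact (ClassWord.fullRel_eq_none_iff (decoClass h w X) (σ x) (σ y)).symm
  | lt x y =>
    refine (TypeDefinable.rel (fun r => ∃ q, r = some (true, q) ∧ True) x y).congr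
      fun w X σ => ?_
    simp only [FO2.Sat, Option.some.injEq, exists_and_left, exists_eq_left']
    exact ((ClassWord.fullRel_eq_true_iff (decoClass h w X) (σ x) (σ y) fun _ => True).trans (iff_of_eq (and_true _))).symm
  | succ x y =>
    refine (TypeDefinable.rel (fun r => ∃ q, r = some (true, q) ∧ q.1) x y).congr
      fun w X σ => ?_
    simp only [FO2.Sat, Option.some.injEq, exists_and_left, exists_eq_left']
    refine Iff.trans ?_ (ClassWord.fullRel_eq_true_iff _ _ _ fun q => q.1).symm
    have := wordClass_covBy h (fun i => (w.label i, {k | i ∈ X k})) w.datum (σ x) (σ y)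
    exact ⟨fun hs => ⟨Fin.lt_def.2 (by omega), this.2 hs⟩, fun hs => this.1 hs.2⟩
  | sim x y =>
    refine (TypeDefinable.rel (fun r => r = none ∨ ∃ t, r = some t ∧ t.2.2 ≠ none) x y).congr
      fun w X σ => ?_
    simp only [FO2.Sat, Option.some.injEq, exists_and_left, exists_eq_left']
    exact (ClassWord.fullRel_sim_iff (decoClass h w X) (σ x) (σ y)).symm
  | classSucc x y =>
    refine (TypeDefinable.rel (fun r => ∃ q, r = some (true, q) ∧
      ∃ c m, q.2 = some (c, m) ∧ c) x y).congr fun w X σ => ?_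
    simp only [FO2.Sat, Option.some.injEq, exists_and_left, exists_eq_left']
    refine Iff.trans ?_ (ClassWord.fullRel_eq_true_iff _ _ _ _).symm
    refine Iff.trans ?_ (and_congr_right' (ClassWord.rel_eq_some_iff _ _ _ fun c _ => c).symm)
    exact ⟨fun hs => ⟨hs.1, hs.2.1, hs⟩, fun hs => hs.2.2⟩
  | guarded L x y =>
    obtain ⟨P, hP⟩ := hF L L.2
    refine (TypeDefinable.rel (fun r => ∃ q, r = some (true, q) ∧
      ∃ c m, q.2 = some (c, m) ∧ m ∈ P) x y).congr fun w X σ => ?_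
    simp only [FO2.Sat, Option.some.injEq, exists_and_left, exists_eq_left']
    refine Iff.trans ?_ (ClassWord.fullRel_eq_true_iff _ _ _ _).symm
    refine Iff.trans ?_ (and_congr_right' (ClassWord.rel_eq_some_iff _ _ _ fun _ m => m ∈ P).symm)
    exact ⟨fun hs => ⟨hs.2.1, hs.1, (hP w X _ _ hs.2.1).1 hs.2.2⟩,
      fun hs => ⟨hs.2.1, hs.1, (hP w X _ _ hs.1).2 hs.2.2⟩⟩
  | neg φ ih => exact ih.neg
  | and φ ψ ih ih' => exact ih.and ih'
  | or φ ψ ih ih' =>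
    refine (ih.neg.and ih'.neg).neg.congr fun w X σ => ?_
    simp only [FO2.Sat]
    tauto
  | all x φ ih =>
    refine ((ih.neg).ex x).neg.congr fun w X σ => ?_
    simp only [FO2.Sat, update_some]
    push Not
    rfl
  | ex x φ ih =>
    refine (ih.ex x).congr fun w X σ => ?_
    simp only [FO2.Sat, update_some]

/-- On nonempty data words, a sentence is equivalent to the existence of a valid annotation. -/
theorem FO2.exists_tileSys (he : Function.Injective e)
    (s : ∀ (w : DataWord A D) (_ : Fin n → Set (Fin w.length)), List C)
    (hF : ∀ L ∈ F, ∃ P : Set M, ∀ w X (i j : Fin w.length), i < j →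
      (((s w X).take j).drop (i + 1) ∈ L ↔ (decoClass h w X).fac i j ∈ P))
    (φ : FO2 A n F) (hφ : φ.IsSentence) :
    ∃ (N : Type) (_ : Finite N) (T : TileSys M N) (i : N → Γ),
      ∀ (w : DataWord A D) (X : Fin n → Set (Fin w.length)), 0 < w.length →
        (φ.Sat w X (s w X) (fun _ => none) ↔
          ∃ ν : Fin w.length → N, T.Valid (decoClass h w X) ν ∧
            ∀ p, i (ν p) = decoLabel e w X p) := by
  obtain ⟨Δ, hΔ, f, Φ, hf, hΦ⟩ := φ.typeDefinable h e he s hF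
  obtain ⟨N, hN, T, i, o, h1, h2⟩ := hf
  -- The product with a trivial system serves to add a unary constraint. A sentence does not depend
  -- on the assignment, so both variables may be placed at the same position, and `Φ` can be tested
  -- there with all relations `none`.
  refine ⟨N × Unit, inferInstance, T.prod (TileSys.free M Unit)
    (fun m _ => Φ (fun _ => o m) fun _ _ => none), fun m => i m.1, fun w X hw => ?_⟩
  have key : ∀ p : Fin w.length, φ.Sat w X (s w X) (fun _ => none) ↔
      Φ (fun _ => f (decoClass h w X) (decoLabel e w X) p) fun _ _ => none := by
    intro p
    rw [φ.sat_congr (τ := fun _ => some p) (by rw [hφ]; exact fun _ h => h.elim)]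
    refine (hΦ w X fun _ => p).trans ?_
    refine Iff.of_eq (congrArg _ ?_)
    funext _ _
    exact ClassWord.fullRel_self _ _
  constructor
  · intro hsat
    obtain ⟨ν, hν, hi⟩ := h1 (decoClass h w X) (decoLabel e w X)
    refine ⟨fun p => (ν p, ()), (TileSys.prod_valid _ _ _ _ _).2
      ⟨hν, TileSys.free_valid _ _, fun p => ?_⟩, hi⟩
    rw [h2 _ ν hν p, funext hi]
    exact (key p).1 hsat
  · rintro ⟨ν, hν, hi⟩
    obtain ⟨hν', -, hR⟩ := (TileSys.prod_valid _ _ _ _ _).1 hν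
    have := hR ⟨0, hw⟩
    rw [h2 _ _ hν' _] at this
    rw [key ⟨0, hw⟩, ← funext hi]
    exact this

end Definability

/-! ### From tile systems to set automata -/

theorem SetAutomaton.reaches_iff_run {B : Type u} {D : Type v} (𝒜 : SetAutomaton B)
    (w : DataWord B D) (c : 𝒜.Config D) :
    𝒜.Reaches w c ↔ ∃ cs : ℕ → 𝒜.Config D, (cs 0).state ∈ 𝒜.init ∧
      (cs 0).sets = (fun _ => ∅) ∧
      (∀ i (hi : i < w.length), 𝒜.Step (cs i) w[i] (cs (i + 1))) ∧ cs w.length = c := by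
  constructor
  · intro h
    induction h with
    | nil q hq => exact ⟨fun _ => ⟨q, fun _ => ∅⟩, hq, rfl, fun i hi => by simp at hi, rfl⟩
    | snoc w c c' p hc hs ih =>
      obtain ⟨cs, h0, h0', h1, h2⟩ := ih
      refine ⟨fun k => if k ≤ w.length then cs k else c', by simpa using h0, by simpa using h0',
        fun i hi => ?_, by simp⟩
      rw [List.length_append, List.length_singleton] at hi
      rcases Nat.lt_succ_iff_lt_or_eq.1 hi with hi' | rfl
      · simp only [hi'.le, if_true, Nat.succ_le_of_lt hi', List.getElem_append_left hi']
        exact h1 i hi'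
      · simp only [le_refl, if_true, Nat.not_succ_le_self, if_false, h2,
          List.getElem_concat_length]
        exact hs
  · rintro ⟨cs, h0, h0', h1, rfl⟩
    have key : ∀ k ≤ w.length, 𝒜.Reaches (w.take k) (cs k) := by
      intro k
      induction k with
      | zero =>
        intro _
        have : cs 0 = ⟨(cs 0).state, fun _ => ∅⟩ := by rw [← h0']
        rw [this]
        exact .nil _ h0
      | succ k ih =>
        intro hk
        rw [← List.take_concat_get' _ _ hk]
        exact .snoc _ _ _ _ (ih (Nat.le_of_succ_le hk)) (h1 k hk)
    simpa using key w.length le_rfl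

/-! ### The automaton of a tile system: construction, quasi-normality and single steps. -/

section Automaton

variable {B : Type u} {D : Type v} {M N : Type} [Monoid M]

/-- The global update multiplying the values stored for the classes by `g`. -/
def trackUpdate (g : M) : M ⊕ N → M ⊕ N → Prop
  | .inl m, y => y = .inl (m * g)
  | .inr n, y => y = .inr n

variable {h : FreeMonoid B →* M} {L : ℕ} (b : Fin L → B) (d : Fin L → D) (ν : Fin L → N)

/-- `q` is the last position before `k` that carries the datum `x`. -/
def LastOcc (k : ℕ) (x : D) (q : Fin L) : Prop :=
  (q : ℕ) < k ∧ d q = x ∧ ∀ j : Fin L, q < j → (j : ℕ) < k → d j ≠ x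

theorem lastOcc_succ (i : Fin L) (x : D) (q : Fin L) :
    LastOcc d (i + 1) x q ↔ (x = d i ∧ q = i) ∨ (x ≠ d i ∧ LastOcc d i x q) := by
  constructor
  · rintro ⟨hq, hx, hj⟩
    rcases Nat.lt_succ_iff_lt_or_eq.1 hq with hlt | heq
    · refine Or.inr ⟨fun h => hj i hlt (Nat.lt_succ_self _) h.symm, hlt, hx,
        fun j h1 h2 => hj j h1 (h2.trans (Nat.lt_succ_self _))⟩
    · obtain rfl := Fin.ext heq
      exact Or.inl ⟨hx.symm, rfl⟩
  · rintro (⟨rfl, rfl⟩ | ⟨hne, hq, hx, hj⟩)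
    · exact ⟨Nat.lt_succ_self _, rfl, fun j h1 h2 => absurd h2 (by have := Fin.lt_def.1 h1; omega)⟩
    · refine ⟨hq.trans (Nat.lt_succ_self _), hx, fun j h1 h2 => ?_⟩
      rcases Nat.lt_succ_iff_lt_or_eq.1 h2 with hlt | heq
      · exact hj j h1 hlt
      · obtain rfl := Fin.ext heq
        exact hne.symm

theorem lastOcc_self_iff (i q : Fin L) :
    LastOcc d i (d i) q ↔ (wordClass h b d).CSucc q i := by
  constructor
  · rintro ⟨h1, h2, h3⟩
    exact ⟨h1, h2, fun j h4 h5 h6 => h3 j h4 h5 (Eq.trans h6 h2)⟩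
  · rintro ⟨h1, h2, h3⟩
    exact ⟨h1, h2, fun j h4 h5 h6 => h3 j h4 h5 (Eq.trans h6 h2.symm)⟩

variable (h) in
/-- The contents of the sets after reading `k` letters. -/
def trackSets (k : ℕ) : M ⊕ N → Set D
  | .inl m => {x | ∃ q, LastOcc d k x q ∧
      h (FreeMonoid.ofList (((List.ofFn b).take k).drop (q + 1))) = m}
  | .inr n => {x | ∃ q, LastOcc d k x q ∧ ν q = n}

/-- The last annotation before the position `k`. -/
def prevState (k : ℕ) : Option N := if hk : 0 < k ∧ k ≤ L then some (ν ⟨k - 1, by omega⟩) else none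

theorem trackSets_zero : trackSets h b d ν 0 = fun _ => ∅ := by
  funext y
  rcases y with m | n <;>
  · refine Set.eq_empty_of_forall_notMem ?_
    rintro x ⟨q, hq, -⟩
    exact absurd hq.1 (Nat.not_lt_zero _)

theorem trackSets_succ (i : Fin L) (y : M ⊕ N) (x : D) :
    x ∈ trackSets h b d ν (i + 1) y ↔
      (x = d i ∧ y ∈ ({Sum.inl 1, Sum.inr (ν i)} : Set (M ⊕ N))) ∨
        x ≠ d i ∧ ∃ z, trackUpdate (h (FreeMonoid.of (b i))) z y ∧
          x ∈ trackSets h b d ν i z := by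
  have hsplit : ∀ q : Fin L, (q : ℕ) < i → ((List.ofFn b).take (i + 1)).drop (q + 1) =
      ((List.ofFn b).take i).drop (q + 1) ++ [b i] := by
    intro q hq
    rw [← List.take_concat_get' _ _ (by simp), List.drop_append_of_le_length (by simp; omega)]
    simp
  have hnil : ((List.ofFn b).take (i + 1)).drop (i + 1) = [] := by simp
  rcases y with m | n
  · constructor
    · rintro ⟨q, hq, hm⟩
      rcases (lastOcc_succ d i x q).1 hq with ⟨hx, rfl⟩ | ⟨hx, hq'⟩
      · rw [hnil] at hm
        exact Or.inl ⟨hx, Or.inl (congrArg Sum.inl (hm.symm.trans (map_one h)))⟩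
      · rw [hsplit q hq'.1] at hm
        refine Or.inr ⟨hx, Sum.inl _, ?_, q, hq', rfl⟩
        refine congrArg Sum.inl (hm.symm.trans ?_)
        rw [FreeMonoid.ofList_append, map_mul]
        rfl
    · rintro (⟨rfl, hy⟩ | ⟨hx, z | n', hz, hxz⟩)
      · simp only [Set.mem_insert_iff, Sum.inl.injEq, Set.mem_singleton_iff, reduceCtorEq,
          or_false] at hy
        subst hy
        exact ⟨i, (lastOcc_succ d i _ i).2 (Or.inl ⟨rfl, rfl⟩), by rw [hnil]; exact map_one h⟩
      · obtain ⟨q, hq, hm⟩ := hxz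
        refine ⟨q, (lastOcc_succ d i _ q).2 (Or.inr ⟨hx, hq⟩), ?_⟩
        have hz' : m = z * _ := Sum.inl.inj hz
        rw [hsplit q hq.1, FreeMonoid.ofList_append, map_mul, hz', hm]
        rfl
      · exact absurd hz (by simp [trackUpdate])
  · constructor
    · rintro ⟨q, hq, rfl⟩
      rcases (lastOcc_succ d i x q).1 hq with ⟨hx, rfl⟩ | ⟨hx, hq'⟩
      · exact Or.inl ⟨hx, Or.inr rfl⟩
      · exact Or.inr ⟨hx, Sum.inr _, rfl, q, hq', rfl⟩
    · rintro (⟨rfl, hy⟩ | ⟨hx, m | n', hz, hxz⟩)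
      · simp only [Set.mem_insert_iff, Sum.inr.injEq, Set.mem_singleton_iff, reduceCtorEq,
          false_or] at hy
        exact ⟨i, (lastOcc_succ d i _ i).2 (Or.inl ⟨rfl, rfl⟩), hy.symm⟩
      · exact absurd hz (by simp [trackUpdate])
      · obtain rfl := Sum.inr.inj hz
        obtain ⟨q, hq, hm⟩ := hxz
        exact ⟨q, (lastOcc_succ d i _ q).2 (Or.inr ⟨hx, hq⟩), hm⟩

/-- The set automaton that guesses and verifies a valid annotation. Every class is stored with
the value of the suffix after its last position, and with the annotation of that position. -/
abbrev TileSys.automaton [Finite M] [Finite N] (T : TileSys M N) (h : FreeMonoid B →* M) (β : N → B)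
    (E : Prop) : SetAutomaton B where
  State := Option N
  Name := M ⊕ N
  trans := {t | ∃ n, t.tgt = some n ∧ t.letter = β n ∧ T.unary (h (FreeMonoid.of t.letter)) n ∧
    (t.src = none → T.first n) ∧ (∀ n', t.src = some n' → T.horiz n' n) ∧
    (t.test = ∅ → T.classFirst n) ∧
    -- The test precedes the update, so `m` does not yet include the current letter.
    (∀ m n', Sum.inl m ∈ t.test → Sum.inr n' ∈ t.test → T.vert n' m n) ∧
    -- No run from an initial configuration is lost, since each datum has only one last occurrence;
    -- the clause is what makes the restricted automaton normal.
    (∀ m m', Sum.inl m ∈ t.test → Sum.inl m' ∈ t.test → m = m') ∧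
    t.update = trackUpdate (h (FreeMonoid.of t.letter)) ∧
    t.add = {Sum.inl 1, Sum.inr n} ∧ t.remove = updateVec t.update t.test \ t.add}
  init := {none}
  final := {s | s = none ∧ E ∨ ∃ n, s = some n ∧ T.last n}
  acc := {z | ∀ n, Sum.inr n ∈ z → T.classLast n}

variable (T : TileSys M N) (h) (β : N → B) (E : Prop)

variable [Finite M] [Finite N]

theorem TileSys.automaton_isQuasiNormalWith :
    (T.automaton h β E).IsQuasiNormalWith (Set.range Sum.inr) := by
  constructor
  · rintro _ ⟨n, rfl⟩ t ⟨n', -, -, -, -, -, -, -, -, hu, -⟩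
    rw [hu]
    constructor
    · ext y
      rfl
    · ext y
      rcases y with m | n''
      · exact ⟨fun hy => (Sum.inr_ne_inl hy).elim,
          fun hy => (Sum.inl_ne_inr hy).elim⟩
      · exact ⟨fun hy => Eq.symm hy, fun hy => Eq.symm hy⟩
  · have hmem : ∀ m : M, (Sum.inl m : M ⊕ N) ∈ (Set.range Sum.inr : Set (M ⊕ N))ᶜ := by simp
    have hcases : ∀ y : ((Set.range Sum.inr : Set (M ⊕ N))ᶜ : Set (M ⊕ N)),
        ∃ m, y = ⟨Sum.inl m, hmem m⟩ := by
      rintro ⟨m | n, hy⟩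
      · exact ⟨m, rfl⟩
      · exact absurd ⟨n, rfl⟩ hy
    rintro _ ⟨t, ⟨n', -, -, -, -, -, -, -, hsub, hu, ha, hr⟩, rfl⟩
    set g := h (FreeMonoid.of t.letter) with hg
    dsimp only
    have hadd : {y : ((Set.range Sum.inr : Set (M ⊕ N))ᶜ : Set (M ⊕ N)) |
        (y : M ⊕ N) ∈ t.add} = {⟨Sum.inl 1, hmem 1⟩} := by
      ext y
      obtain ⟨m, rfl⟩ := hcases y
      rw [ha]
      refine ⟨fun hy => ?_, fun hy => Or.inl (Subtype.mk.inj hy)⟩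
      exact Subtype.ext (hy.resolve_right fun hy' => Sum.inl_ne_inr hy')
    have hupd : ∀ m, (⟨Sum.inl m, hmem m⟩ : ((Set.range Sum.inr : Set (M ⊕ N))ᶜ : Set (M ⊕ N))) ∈
        updateVec (fun x y : ((Set.range Sum.inr : Set (M ⊕ N))ᶜ : Set (M ⊕ N)) =>
          t.update x y) {y | (y : M ⊕ N) ∈ t.test} ↔ Sum.inl m ∈ updateVec t.update t.test := by
      intro m
      constructor
      · rintro ⟨x, hx, hxy⟩
        exact ⟨x, hx, hxy⟩
      · rintro ⟨x | n, hx, hxy⟩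
        · exact ⟨⟨Sum.inl x, hmem x⟩, hx, hxy⟩
        · rw [hu] at hxy
          exact absurd hxy (by simp [trackUpdate])
    have huniq : ∀ m m', Sum.inl m ∈ updateVec t.update t.test →
        Sum.inl m' ∈ updateVec t.update t.test → m = m' := by
      rintro m m' ⟨x | n, hx, hxy⟩ ⟨x' | n', hx', hxy'⟩ <;> rw [hu] at hxy hxy' <;>
        simp only [trackUpdate, Sum.inl.injEq, reduceCtorEq] at hxy hxy'
      rw [hxy, hxy', hsub _ _ hx hx']
    refine ⟨fun x => ?_, ⟨_, hadd⟩, fun hne => ?_, fun heq => ?_⟩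
    · obtain ⟨m, rfl⟩ := hcases x
      refine ⟨⟨Sum.inl (m * g), hmem _⟩, ?_, fun y hy => ?_⟩
      · dsimp only
        rw [hu]
        rfl
      · dsimp only at hy
        rw [hu] at hy
        exact Subtype.ext hy
    · replace hne := fun heq => hne (hadd.trans heq)
      ext y
      obtain ⟨m, rfl⟩ := hcases y
      refine Iff.trans ?_ (hupd m).symm
      change Sum.inl m ∈ t.remove ↔ _
      rw [hr]
      -- By `huniq` the restricted image of the test has at most one element. If that element were
      -- `Sum.inl 1`, the image would equal the restriction of `t.add`, which `hne` excludes; so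
      -- deleting `t.add` from it changes nothing.
      refine ⟨fun hy => hy.1, fun hy => ⟨hy, fun hm => hne ?_⟩⟩
      rw [ha] at hm
      obtain rfl := Sum.inl.inj (hm.resolve_right fun hy' => Sum.inl_ne_inr hy')
      refine Set.ext fun y => ?_
      obtain ⟨m', rfl⟩ := hcases y
      refine ⟨fun h' => (hupd m').2 ?_,
        fun h' => Subtype.ext (congrArg Sum.inl (huniq _ _ ((hupd m').1 h') hy))⟩
      obtain rfl := Sum.inl.inj (Subtype.mk.inj h')
      exact hy
    · replace heq := hadd.symm.trans heq
      ext y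
      obtain ⟨m, rfl⟩ := hcases y
      refine ⟨fun hy => ?_, fun hy => hy.elim⟩
      replace hy : Sum.inl m ∈ t.remove := hy
      rw [hr] at hy
      have h' := (Set.ext_iff.1 heq ⟨Sum.inl m, hmem m⟩).2 ((hupd m).2 hy.1)
      obtain rfl := Sum.inl.inj (Subtype.mk.inj h')
      exact hy.2 (by rw [ha]; exact Or.inl rfl)

variable {h T β E}

theorem TileSys.automaton_step_iff (c c' : (T.automaton h β E).Config D) (p : B × D) :
    (T.automaton h β E).Step c p c' ↔
      ∃ n, c'.state = some n ∧ β n = p.1 ∧ T.unary (h (FreeMonoid.of p.1)) n ∧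
        (c.state = none → T.first n) ∧ (∀ n', c.state = some n' → T.horiz n' n) ∧
        ((∀ y, p.2 ∉ c.sets y) → T.classFirst n) ∧
        (∀ m n', p.2 ∈ c.sets (Sum.inl m) → p.2 ∈ c.sets (Sum.inr n') → T.vert n' m n) ∧
        (∀ m m', p.2 ∈ c.sets (Sum.inl m) → p.2 ∈ c.sets (Sum.inl m') → m = m') ∧
        ∀ y x, x ∈ c'.sets y ↔ (x = p.2 ∧ y ∈ ({Sum.inl 1, Sum.inr n} : Set (M ⊕ N))) ∨
          x ≠ p.2 ∧ ∃ z, trackUpdate (h (FreeMonoid.of p.1)) z y ∧ x ∈ c.sets z := by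
  have hset : ∀ (n : N) (y : M ⊕ N) (x : D),
      x ∈ ((⋃ z ∈ {z | trackUpdate (h (FreeMonoid.of p.1)) z y}, c.sets z) ∪
        {e | e = p.2 ∧ y ∈ ({Sum.inl 1, Sum.inr n} : Set (M ⊕ N))}) \
        {e | e = p.2 ∧ y ∈ updateVec (trackUpdate (h (FreeMonoid.of p.1))) (charVec c.sets p.2) \
          {Sum.inl 1, Sum.inr n}} ↔
      (x = p.2 ∧ y ∈ ({Sum.inl 1, Sum.inr n} : Set (M ⊕ N))) ∨
          x ≠ p.2 ∧ ∃ z, trackUpdate (h (FreeMonoid.of p.1)) z y ∧ x ∈ c.sets z := by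
    intro n y x
    have hup : y ∈ updateVec (trackUpdate (h (FreeMonoid.of p.1))) (charVec c.sets p.2) ↔
        ∃ z, trackUpdate (h (FreeMonoid.of p.1)) z y ∧ p.2 ∈ c.sets z :=
      ⟨fun ⟨z, h1, h2⟩ => ⟨z, h2, h1⟩, fun ⟨z, h1, h2⟩ => ⟨z, h2, h1⟩⟩
    simp only [Set.mem_sdiff, Set.mem_union, Set.mem_iUnion, Set.mem_ofPred_eq, hup, exists_prop]
    by_cases hx : x = p.2
    · rw [hx]
      by_cases hy : y ∈ ({Sum.inl 1, Sum.inr n} : Set (M ⊕ N))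
      · simp only [hy, and_self, or_true, not_true_eq_false, and_false, not_false_eq_true, true_or]
      · simp only [hy, and_false, or_false, not_false_eq_true, and_true, true_and, and_not_self_iff,
          ne_eq, not_true_eq_false, false_and]
    · simp only [hx, false_and, or_false, not_false_eq_true, and_true, ne_eq, true_and, false_or]
  constructor
  · rintro ⟨t, ⟨n, h1, h2, h3, h4, h5, h6, h7, h8, h9, h10, h11⟩, k1, k2, k3, k4, k5⟩
    rw [← k4, ← k1]
    rw [k2] at h2 h3 h9
    refine ⟨n, h1, h2.symm, h3, h4, h5, fun hy => h6 ?_, fun m n' hm hn => h7 m n' ?_ ?_,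
      fun m m' hm hm' => h8 m m' ?_ ?_, fun y x => ?_⟩
    · rw [k3]
      exact Set.eq_empty_of_forall_notMem hy
    · rw [k3]; exact hm
    · rw [k3]; exact hn
    · rw [k3]; exact hm
    · rw [k3]; exact hm'
    · rw [k5, h11, h10, h9, k3]
      exact hset n y x
  · rintro ⟨n, h1, h2, h3, h4, h5, h6, h7, h8, h9⟩
    refine ⟨⟨c.state, p.1, charVec c.sets p.2, trackUpdate (h (FreeMonoid.of p.1)),
      {Sum.inl 1, Sum.inr n}, updateVec (trackUpdate (h (FreeMonoid.of p.1)))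
        (charVec c.sets p.2) \ {Sum.inl 1, Sum.inr n}, some n⟩, ⟨n, rfl, h2.symm, h3, h4, h5, fun hy => h6 fun y hy' => ?_,
      h7, h8, rfl, rfl, rfl⟩, rfl, rfl, rfl, h1.symm, fun y => ?_⟩
    · have : y ∈ (charVec c.sets p.2) := hy'
      rw [show charVec c.sets p.2 = ∅ from hy] at this
      exact this
    · ext x
      rw [h9]
      exact (hset n y x).symm

variable (h T β) in
/-- The constraints concerning a position and its predecessors. -/
def LocalValid (i : Fin L) : Prop :=
  β (ν i) = b i ∧ T.unary (h (FreeMonoid.of (b i))) (ν i) ∧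
    (prevState ν i = none → T.first (ν i)) ∧
    (∀ n', prevState ν i = some n' → T.horiz n' (ν i)) ∧
    ((∀ q, ¬ (wordClass h b d).CSucc q i) → T.classFirst (ν i)) ∧
    ∀ q, (wordClass h b d).CSucc q i → T.vert (ν q) ((wordClass h b d).fac q i) (ν i)

/-- When the sets hold the last occurrences, the datum `d i` is found in `Sum.inl m` and `Sum.inr n`
exactly for the factor since its class predecessor and the annotation there. The tests of a
transition are then the local constraints at `i`. -/
theorem TileSys.automaton_step_trackSets_iff (i : Fin L) (c c' : (T.automaton h β E).Config D)
    (hc : c.state = prevState ν i) (hcs : c.sets = trackSets h b d ν i)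
    (hc' : c'.state = some (ν i)) :
    (T.automaton h β E).Step c (b i, d i) c' ↔
      LocalValid h b d ν T β i ∧ c'.sets = trackSets h b d ν (i + 1) := by
  rw [TileSys.automaton_step_iff]
  have hsets : c'.sets = trackSets h b d ν (i + 1) ↔
      ∀ y x, x ∈ c'.sets y ↔ (x = d i ∧ y ∈ ({Sum.inl 1, Sum.inr (ν i)} : Set (M ⊕ N))) ∨
          x ≠ d i ∧ ∃ z, trackUpdate (h (FreeMonoid.of (b i))) z y ∧ x ∈ c.sets z := by
    rw [hcs]
    exact ⟨fun h' y x => by rw [h']; exact trackSets_succ b d ν i y x,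
      fun h' => funext fun y => Set.ext fun x =>
        (h' y x).trans (trackSets_succ b d ν i y x).symm⟩
  have hinl : ∀ m, d i ∈ c.sets (Sum.inl m) ↔
      ∃ q, (wordClass h b d).CSucc q i ∧ (wordClass h b d).fac q i = m := by
    intro m
    rw [hcs]
    exact exists_congr fun q => and_congr (lastOcc_self_iff b d i q) Iff.rfl
  have hinr : ∀ n, d i ∈ c.sets (Sum.inr n) ↔
      ∃ q, (wordClass h b d).CSucc q i ∧ ν q = n := by
    intro m
    rw [hcs]
    exact exists_congr fun q => and_congr (lastOcc_self_iff b d i q) Iff.rfl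
  have hempty : (∀ y, d i ∉ c.sets y) ↔ ∀ q, ¬ (wordClass h b d).CSucc q i := by
    constructor
    · exact fun hy q hq => hy (Sum.inl _) ((hinl _).2 ⟨q, hq, rfl⟩)
    · rintro hq (m | n) hy
      · obtain ⟨q, hq', -⟩ := (hinl _).1 hy
        exact hq q hq'
      · obtain ⟨q, hq', -⟩ := (hinr _).1 hy
        exact hq q hq'
  rw [hsets, LocalValid, ← hempty, ← hc]
  constructor
  · rintro ⟨n, h1, h2, h3, h4, h5, h6, h7, h8, h9⟩
    obtain rfl : ν i = n := Option.some.inj (hc'.symm.trans h1)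
    exact ⟨⟨h2, h3, h4, h5, h6, fun q hq => h7 _ _ ((hinl _).2 ⟨q, hq, rfl⟩)
      ((hinr _).2 ⟨q, hq, rfl⟩)⟩, h9⟩
  · rintro ⟨⟨h2, h3, h4, h5, h6, h7⟩, h9⟩
    refine ⟨ν i, hc', h2, h3, h4, h5, h6, fun m n' hm hn => ?_, fun m m' hm hm' => ?_, h9⟩
    · obtain ⟨q, hq, rfl⟩ := (hinl _).1 hm
      obtain ⟨q', hq', rfl⟩ := (hinr _).1 hn
      obtain rfl := hq.unique hq'
      exact h7 q hq
    · obtain ⟨q, hq, rfl⟩ := (hinl _).1 hm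
      obtain ⟨q', hq', rfl⟩ := (hinl _).1 hm'
      obtain rfl := hq.unique hq'
      rfl

end Automaton

/-! ### Runs of the automaton and valid annotations. -/

section Automaton

theorem prevState_succ {N : Type} {L : ℕ} (ν : Fin L → N) (i : Fin L) : prevState ν (i + 1) = some (ν i) := by
  rw [prevState, dif_pos ⟨Nat.succ_pos _, i.2⟩]
  rfl

variable {B : Type u} {D : Type v} {M N : Type} [Monoid M]
  {T : TileSys M N} {h : FreeMonoid B →* M} {β : N → B} {E : Prop} {L : ℕ}
  (b : Fin L → B) (d : Fin L → D)

/-- Reading from left to right checks each position against its past. What remains are the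
constraints on final positions: the last state sees the last one, and the last occurrences at the
end of the word are the final positions of the classes. -/
theorem forall_localValid_iff (ν : Fin L → N) :
    (∀ i, LocalValid h b d ν T β i) ∧ (∀ n, prevState ν L = some n → T.last n) ∧
      (∀ x q, LastOcc d L x q → T.classLast (ν q)) ↔
    T.Valid (wordClass h b d) ν ∧ ∀ i, β (ν i) = b i := by
  have hcov : ∀ p q : Fin L, @CovBy (wordClass h b d).Pos _ p q ↔ (p : ℕ) + 1 = q :=
    fun p q => wordClass_covBy h b d p q
  have hprev : ∀ i : Fin L, ∀ n, prevState ν i = some n ↔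
      ∃ p : Fin L, (p : ℕ) + 1 = i ∧ ν p = n := by
    intro i n
    constructor
    · intro hn
      by_cases hk : 0 < (i : ℕ) ∧ (i : ℕ) ≤ L
      · rw [prevState, dif_pos hk] at hn
        exact ⟨⟨i - 1, by omega⟩, by simp; omega, Option.some.inj hn⟩
      · rw [prevState, dif_neg hk] at hn
        cases hn
    · rintro ⟨p, hp, rfl⟩
      rw [← hp, prevState_succ]
  have hnone : ∀ i : Fin L, prevState ν i = none ↔ ∀ q : Fin L, ¬ q < i := by
    intro i
    constructor
    · intro hn q hq
      have hq' : (q : ℕ) < i := hq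
      rw [prevState, dif_pos ⟨by omega, i.2.le⟩] at hn
      cases hn
    · intro hq
      rw [prevState, dif_neg]
      intro hk
      exact hq ⟨i - 1, by omega⟩ (Fin.lt_def.2 (by simp; omega))
  have hlast : ∀ n, prevState ν L = some n ↔ ∃ p : Fin L, (∀ q, ¬ p < q) ∧ ν p = n := by
    intro n
    constructor
    · intro hn
      by_cases hk : 0 < L ∧ L ≤ L
      · rw [prevState, dif_pos hk] at hn
        refine ⟨⟨L - 1, by omega⟩, fun q hq => ?_, Option.some.inj hn⟩
        have := Fin.lt_def.1 hq
        simp only at this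
        omega
      · rw [prevState, dif_neg hk] at hn
        cases hn
    · rintro ⟨p, hp, rfl⟩
      have hpL : (p : ℕ) + 1 = L := by
        by_contra hne
        exact hp ⟨p + 1, by omega⟩ (Fin.lt_def.2 (by simp))
      have := prevState_succ ν p
      rwa [hpL] at this
  have hcf : ∀ i : Fin L, (∀ q, ¬ (wordClass h b d).CSucc q i) ↔
      ∀ q : Fin L, q < i → ¬ (wordClass h b d).sim q i := by
    intro i
    constructor
    · intro hq q hlt hs
      obtain ⟨r, hr⟩ := ClassWord.exists_cSucc (S := wordClass h b d) hlt hs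
      exact hq r hr
    · exact fun hq q hs => hq q hs.1 hs.2.1
  have hlo : ∀ q, LastOcc d L (d q) q ↔ ∀ j, q < j → ¬ d q = d j := by
    intro q
    exact ⟨fun hq j hj hs => hq.2.2 j hj j.2 hs.symm,
      fun hq => ⟨q.2, rfl, fun j hj _ hs => hq j hj hs.symm⟩⟩
  constructor
  · rintro ⟨h1, h2, h3⟩
    refine ⟨⟨fun p => (h1 p).2.1, fun p q hpq => ?_, fun p q hpq => (h1 q).2.2.2.2.2 p hpq,
      fun p hp => (h1 p).2.2.1 ((hnone p).2 hp), fun p hp => h2 _ ((hlast _).2 ⟨p, hp, rfl⟩),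
      fun p hp => (h1 p).2.2.2.2.1 ((hcf p).2 hp), fun p hp => h3 _ p ((hlo p).2 hp)⟩,
      fun i => (h1 i).1⟩
    exact (h1 q).2.2.2.1 _ ((hprev q _).2 ⟨p, (hcov p q).1 hpq, rfl⟩)
  · rintro ⟨⟨h1, h2, h3, h4, h5, h6, h7⟩, h8⟩
    refine ⟨fun i => ⟨h8 i, h1 i, fun hn => h4 i ((hnone i).1 hn), fun n hn => ?_,
      fun hq => h6 i ((hcf i).1 hq), fun q hq => h3 q i hq⟩, fun n hn => ?_, fun x q hq => ?_⟩
    · obtain ⟨p, hp, rfl⟩ := (hprev i n).1 hn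
      exact h2 p i ((hcov p i).2 hp)
    · obtain ⟨p, hp, rfl⟩ := (hlast n).1 hn
      exact h5 p hp
    · obtain rfl := hq.2.1
      exact h7 q ((hlo q).1 hq)

variable [Finite M] [Finite N]

/-- The only freedom of a run is the annotation in the target state of each step; the sets then
evolve deterministically and stay equal to `trackSets`. -/
theorem TileSys.automaton_reaches_iff (c : (T.automaton h β E).Config D) :
    (T.automaton h β E).Reaches (List.ofFn fun i => (b i, d i)) c ↔
      ∃ ν : Fin L → N, (∀ i, LocalValid h b d ν T β i) ∧ c.state = prevState ν L ∧
        c.sets = trackSets h b d ν L := by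
  rw [SetAutomaton.reaches_iff_run]
  constructor
  · rintro ⟨cs, h0, h0', h1, hL⟩
    rw [List.length_ofFn] at hL
    have hstep : ∀ i : Fin L,
        (T.automaton h β E).Step (cs i) (b i, d i) (cs (i + 1)) := by
      intro i
      simpa using h1 i (by simp)
    have hst : ∀ i : Fin L, ∃ n, (cs (i + 1)).state = some n := fun i =>
      ((TileSys.automaton_step_iff _ _ _).1 (hstep i)).imp fun n hn => hn.1
    choose ν hν using hst
    have hstate : ∀ k ≤ L, (cs k).state = prevState ν k := by
      rintro (_ | k) hk
      · rw [Set.mem_singleton_iff.1 h0]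
        rfl
      · exact (hν ⟨k, hk⟩).trans (prevState_succ ν ⟨k, hk⟩).symm
    have hsets : ∀ k ≤ L, (cs k).sets = trackSets h b d ν k := by
      intro k
      induction k with
      | zero => exact fun _ => h0'.trans (trackSets_zero b d ν).symm
      | succ k ih =>
        intro hk
        exact ((TileSys.automaton_step_trackSets_iff b d ν ⟨k, hk⟩ _ _
          (hstate k (Nat.le_of_succ_le hk)) (ih (Nat.le_of_succ_le hk)) (hν ⟨k, hk⟩)).1
            (hstep ⟨k, hk⟩)).2
    refine ⟨ν, fun i => ((TileSys.automaton_step_trackSets_iff b d ν i _ _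
      (hstate i i.2.le) (hsets i i.2.le) (hν i)).1 (hstep i)).1, ?_, ?_⟩
    · rw [← hL]; exact hstate L le_rfl
    · rw [← hL]; exact hsets L le_rfl
  · rintro ⟨ν, hν, hc, hc'⟩
    refine ⟨fun k => ⟨prevState ν k, trackSets h b d ν k⟩, rfl, trackSets_zero b d ν,
      fun i hi => ?_, ?_⟩
    · rw [List.length_ofFn] at hi
      rw [List.getElem_ofFn]
      exact (TileSys.automaton_step_trackSets_iff b d ν ⟨i, hi⟩ _ _ rfl rfl
        (prevState_succ ν ⟨i, hi⟩)).2 ⟨hν _, rfl⟩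
    · rw [List.length_ofFn]
      change (⟨prevState ν L, trackSets h b d ν L⟩ : (T.automaton h β E).Config D) = c
      rw [← hc, ← hc']

theorem TileSys.mem_automaton_language_iff :
    (List.ofFn fun i => (b i, d i)) ∈ (T.automaton h β E).language D ↔
      (L = 0 ∧ E) ∨ (0 < L ∧
        ∃ ν : Fin L → N, T.Valid (wordClass h b d) ν ∧ ∀ i, β (ν i) = b i) := by
  have hacc : ∀ (ν : Fin L → N), (∀ x, (∃ y, x ∈ trackSets h b d ν L y) →
      charVec (trackSets h b d ν L) x ∈ (T.automaton h β E).acc) ↔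
        ∀ x q, LastOcc d L x q → T.classLast (ν q) := by
    intro ν
    constructor
    · exact fun hx x q hq => hx x ⟨Sum.inr (ν q), q, hq, rfl⟩ _ ⟨q, hq, rfl⟩
    · rintro hx x - n ⟨q, hq, rfl⟩
      exact hx x q hq
  -- The state `none` occurs only before the first letter, so `E` alone decides about the empty
  -- word.
  rcases Nat.eq_zero_or_pos L with rfl | hL
  · constructor
    · rintro ⟨c, hc, hcF, -⟩
      obtain ⟨ν, -, hs, -⟩ := (TileSys.automaton_reaches_iff b d c).1 hc
      rcases hcF with ⟨-, hE⟩ | ⟨n, hn, -⟩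
      · exact Or.inl ⟨rfl, hE⟩
      · rw [hs] at hn
        cases hn
    · rintro (⟨-, hE⟩ | ⟨h0, -⟩)
      · refine ⟨⟨none, trackSets h b d (fun i => i.elim0) 0⟩,
          (TileSys.automaton_reaches_iff b d _).2 ⟨fun i => i.elim0, fun i => i.elim0, rfl, rfl⟩,
          Or.inl ⟨rfl, hE⟩, (hacc _).2 fun _ q => q.elim0⟩
      · exact absurd h0 (lt_irrefl 0)
  · have hps : ∀ ν : Fin L → N, prevState ν L = some (ν ⟨L - 1, by omega⟩) := fun ν => by
      rw [prevState, dif_pos ⟨hL, le_rfl⟩]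
    simp only [hL, hL.ne', false_and, false_or, true_and, ← forall_localValid_iff]
    constructor
    · rintro ⟨c, hc, hcF, hcA⟩
      obtain ⟨ν, hν, hs, hs'⟩ := (TileSys.automaton_reaches_iff b d c).1 hc
      rw [hs] at hcF
      rw [hs'] at hcA
      refine ⟨ν, hν, fun n hn => ?_, (hacc ν).1 hcA⟩
      rcases hcF with ⟨h0, -⟩ | ⟨n', hn', hl⟩
      · rw [hps] at h0
        cases h0
      · rw [hn] at hn'
        exact Option.some.inj hn' ▸ hl
    · rintro ⟨ν, hν, hl, ha⟩
      exact ⟨⟨prevState ν L, trackSets h b d ν L⟩,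
        (TileSys.automaton_reaches_iff b d _).2 ⟨ν, hν, rfl, rfl⟩,
        Or.inr ⟨_, hps ν, hl _ (hps ν)⟩, (hacc ν).2 ha⟩

theorem TileSys.automaton_isSuffixStoring (D : Type v) :
    (T.automaton h β E).IsSuffixStoring D h := by
  have hmem : ∀ m : M, (Sum.inl m : M ⊕ N) ∈ (Set.range Sum.inr : Set (M ⊕ N))ᶜ := by simp
  refine ⟨Set.range Sum.inr, TileSys.automaton_isQuasiNormalWith _ _ _ _,
    Equiv.ofBijective (fun m => ⟨Sum.inl m, hmem m⟩) ⟨fun m m' hm =>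
      Sum.inl.inj (Subtype.mk.inj hm), ?_⟩, fun w c hc m => ?_⟩
  · rintro ⟨m | n, hy⟩
    · exact ⟨m, rfl⟩
    · exact absurd ⟨n, rfl⟩ hy
  · rintro ⟨x, hx⟩
    rw [← List.ofFn_get w] at hc
    obtain ⟨ν, -, -, hs⟩ := (TileSys.automaton_reaches_iff
      (fun i => (w.get i).1) (fun i => (w.get i).2) c).1 hc
    rw [hs] at hx
    obtain ⟨q, -, hm⟩ := hx
    have hstr : List.ofFn (fun i => (w.get i).1) = w.str := by
      rw [DataWord.str]
      conv_rhs => rw [← List.ofFn_get w, List.map_ofFn]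
      rfl
    -- The suffix after the last occurrence `q` of the stored datum.
    refine ⟨w.str.drop (q + 1), List.drop_suffix _ _, ?_⟩
    rw [← hm, hstr, List.take_of_length_le (by simp [DataWord.str])]

end Automaton

/-! ### Renaming letters and values -/

namespace SetAutomaton

variable {A B : Type u} {D : Type v}

theorem rename_isQuasiNormalWith {𝒜 : SetAutomaton B} {S : Set 𝒜.Name}
    (hS : 𝒜.IsQuasiNormalWith S) (f : B → A) : (𝒜.rename f).IsQuasiNormalWith S := by
  refine ⟨?_, ?_⟩
  · rintro y hy _ ⟨t, ht, rfl⟩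
    exact hS.1 y hy t ht
  · rintro _ ⟨_, ⟨t, ht, rfl⟩, rfl⟩
    exact hS.2 _ ⟨t, ht, rfl⟩

theorem rename_step_iff (𝒜 : SetAutomaton B) (f : B → A) (c c' : 𝒜.Config D) (p : A × D) :
    (𝒜.rename f).Step ⟨c.state, c.sets⟩ p ⟨c'.state, c'.sets⟩ ↔
      ∃ x, f x = p.1 ∧ 𝒜.Step c (x, p.2) c' := by
  constructor
  · rintro ⟨_, ⟨t, ht, rfl⟩, h1, h2, h3⟩
    exact ⟨t.letter, h2, t, ht, h1, rfl, h3⟩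
  · rintro ⟨x, hx, t, ht, h1, rfl, h3⟩
    exact ⟨_, ⟨t, ht, rfl⟩, h1, hx, h3⟩

theorem rename_reaches_iff (𝒜 : SetAutomaton B) (f : B → A) (w : DataWord A D)
    (c : (𝒜.rename f).Config D) : (𝒜.rename f).Reaches w c ↔
      ∃ w' : DataWord B D, w'.map (Prod.map f id) = w ∧ 𝒜.Reaches w' ⟨c.state, c.sets⟩ := by
  constructor
  · intro hc
    induction hc with
    | nil q hq => exact ⟨[], rfl, .nil (𝒜 := 𝒜) q hq⟩
    | snoc w c c' p hc hs ih =>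
      obtain ⟨w', rfl, hw'⟩ := ih
      obtain ⟨x, hx, hxs⟩ := (rename_step_iff 𝒜 f ⟨c.state, c.sets⟩ ⟨c'.state, c'.sets⟩ p).1 hs
      exact ⟨w' ++ [(x, p.2)], by simp [hx], .snoc _ _ _ _ hw' hxs⟩
  · have key : ∀ (w' : DataWord B D) (c : 𝒜.Config D), 𝒜.Reaches w' c →
        (𝒜.rename f).Reaches (w'.map (Prod.map f id)) ⟨c.state, c.sets⟩ := by
      intro w' c hc
      induction hc with
      | nil q hq => exact .nil (𝒜 := 𝒜.rename f) q hq
      | snoc w c c' p hc hs ih =>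
        rw [List.map_append]
        exact .snoc _ _ _ _ ih ((rename_step_iff 𝒜 f c c' (f p.1, p.2)).2 ⟨p.1, rfl, hs⟩)
    rintro ⟨w', rfl, hw'⟩
    exact key w' _ hw'

theorem rename_language (𝒜 : SetAutomaton B) (f : B → A) :
    (𝒜.rename f).language D = List.map (Prod.map f id) '' 𝒜.language D := by
  ext w
  constructor
  · rintro ⟨c, hc, hA⟩
    obtain ⟨w', rfl, hw'⟩ := (rename_reaches_iff 𝒜 f w c).1 hc
    exact ⟨w', ⟨_, hw', hA⟩, rfl⟩
  · rintro ⟨w', ⟨c, hc, hA⟩, rfl⟩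
    exact ⟨⟨c.state, c.sets⟩, (rename_reaches_iff 𝒜 f _ _).2 ⟨w', rfl, hc⟩, hA⟩

theorem IsSuffixStoring.rename {𝒜 : SetAutomaton B} {M : Type*} [Monoid M] (f : B → A)
    {h : FreeMonoid A →* M} (h𝒜 : 𝒜.IsSuffixStoring D (h.comp (FreeMonoid.map f))) :
    (𝒜.rename f).IsSuffixStoring D h := by
  obtain ⟨S, hS, X, hX⟩ := h𝒜
  refine ⟨S, rename_isQuasiNormalWith hS f, X, fun w c hc m hm => ?_⟩
  obtain ⟨w', rfl, hw'⟩ := (rename_reaches_iff 𝒜 f w c).1 hc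
  obtain ⟨s, hs, hsm⟩ := hX w' _ hw' m hm
  refine ⟨s.map f, ?_, hsm⟩
  have : DataWord.str (w'.map (Prod.map f id)) = w'.str.map f := by
    simp [DataWord.str]
  rw [this]
  exact hs.map f

theorem IsSuffixStoring.of_mulEquiv {𝒜 : SetAutomaton B} {M M' : Type*} [Monoid M] [Monoid M']
    (e : M ≃* M') {h : FreeMonoid B →* M}
    (h𝒜 : 𝒜.IsSuffixStoring D (e.toMonoidHom.comp h)) : 𝒜.IsSuffixStoring D h := by
  obtain ⟨S, hS, X, hX⟩ := h𝒜
  refine ⟨S, hS, e.toEquiv.trans X, fun w c hc m hm => ?_⟩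
  obtain ⟨s, hs, hsm⟩ := hX w c hc (e m) hm
  exact ⟨s, hs, e.injective hsm⟩

end SetAutomaton

/-! ### Assembling the automata for sentences. -/

section Main

variable {A : Type u} {D : Type v} {n : ℕ}

theorem DataWord.exists_eq_decorate (w' : DataWord (A × Set (Fin n)) D) :
    ∃ (w : DataWord A D) (X : Fin n → Set (Fin w.length)), w' = w.decorate X := by
  refine ⟨w'.map fun p => (p.1.1, p.2),
    fun k => {i | k ∈ (w'[(i : ℕ)]'(by simpa using i.2)).1.2}, ?_⟩
  refine List.ext_getElem (by simp [DataWord.decorate]) fun i h1 h2 => ?_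
  simp [DataWord.decorate, DataWord.label, DataWord.datum]

theorem DataWord.decorate_str (w : DataWord A D) (X : Fin n → Set (Fin w.length)) :
    (w.decorate X).str = List.ofFn fun i => (w.label i, {k | i ∈ X k}) := by
  rw [DataWord.str, DataWord.decorate, List.map_ofFn]
  rfl

theorem DataWord.decorate_str_map_fst (w : DataWord A D) (X : Fin n → Set (Fin w.length)) :
    (w.decorate X).str.map Prod.fst = w.str := by
  rw [DataWord.decorate_str, List.map_ofFn, DataWord.str]
  conv_rhs => rw [← List.ofFn_get w, List.map_ofFn]
  rfl

theorem DataWord.map_decorate (w : DataWord A D) (X : Fin n → Set (Fin w.length)) :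
    (w.decorate X).map (Prod.map Prod.fst id) = w := by
  rw [DataWord.decorate, List.map_ofFn]
  conv_rhs => rw [← List.ofFn_get w]
  rfl

/-- Sentences whose guarded predicates can be evaluated in terms of `h` are recognised by
suffix-storing set automata reading the interpretation of the set variables. -/
theorem FO2.exists_setAutomaton [Finite A] {C : Type*} {F : Set (Language C)} {M : Type*}
    [Monoid M] [Finite M] (h : FreeMonoid (A × Set (Fin n)) →* M)
    (s : ∀ (w : DataWord A D) (_ : Fin n → Set (Fin w.length)), List C)
    (hF : ∀ L ∈ F, ∃ P : Set M, ∀ w X (i j : Fin w.length),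
      (((s w X).take j).drop (i + 1) ∈ L ↔
        h (FreeMonoid.ofList (((w.decorate X).str.take j).drop (i + 1))) ∈ P))
    (φ : FO2 A n F) (hφ : φ.IsSentence) :
    ∃ 𝒜 : SetAutomaton (A × Set (Fin n)), 𝒜.IsSuffixStoring D h ∧
      𝒜.language D = {w' | ∃ (w : DataWord A D) (X : Fin n → Set (Fin w.length)),
        w' = w.decorate X ∧ φ.Sat w X (s w X) fun _ => none} := by
  -- Set names and states live in `Type`, so the finite monoid and alphabet are replaced by small
  -- copies.
  let e : M ≃* Shrink.{0} M := Shrink.mulEquiv.{0}.symm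
  let e' : A × Set (Fin n) ≃ Shrink.{0} (A × Set (Fin n)) := equivShrink _
  have hfin : Finite (Shrink.{0} M) := Finite.of_equiv _ e.toEquiv
  have hfin' : Finite (Shrink.{0} (A × Set (Fin n))) := Finite.of_equiv _ e'
  obtain ⟨N, hN, T, i, hT⟩ := φ.exists_tileSys (D := D) (e.toMonoidHom.comp h) e' e'.injective s
    (fun L hL => by
      obtain ⟨P, hP⟩ := hF L hL
      refine ⟨e '' P, fun w X i j _ => (hP w X i j).trans ?_⟩
      rw [DataWord.decorate_str]
      exact (e.injective.mem_set_image).symm) hφ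
  -- The flag `E` is the truth of the sentence on the empty word, where the set variables have only
  -- one interpretation.
  refine ⟨T.automaton (e.toMonoidHom.comp h) (fun m => e'.symm (i m))
    (∃ X : Fin n → Set (Fin ([] : DataWord A D).length), φ.Sat [] X (s [] X) fun _ => none),
    .of_mulEquiv e (TileSys.automaton_isSuffixStoring D), ?_⟩
  have key : ∀ (w : DataWord A D) (X : Fin n → Set (Fin w.length)),
      w.decorate X ∈ (T.automaton (e.toMonoidHom.comp h) (fun m => e'.symm (i m))
    (∃ X : Fin n → Set (Fin ([] : DataWord A D).length),
      φ.Sat [] X (s [] X) fun _ => none)).language D ↔ φ.Sat w X (s w X) fun _ => none := by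
    intro w X
    refine (TileSys.mem_automaton_language_iff _ _).trans ?_
    rcases w with _ | ⟨p, w⟩
    · simp only [List.length_nil, true_and, lt_irrefl, false_and, or_false]
      refine ⟨?_, fun hX => ⟨X, hX⟩⟩
      rintro ⟨X', hX'⟩
      have hXX : X = X' := funext fun k => Set.ext fun j => j.elim0
      rwa [hXX]
    · have hpos : 0 < List.length (p :: w) := Nat.succ_pos _
      simp only [hpos, hpos.ne', false_and, false_or, true_and]
      refine Iff.trans ?_ (hT (p :: w) X hpos).symm
      refine exists_congr fun ν => and_congr_right' (forall_congr' fun j => ?_)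
      exact e'.symm_apply_eq
  ext w'
  constructor
  · intro hw'
    obtain ⟨w, X, rfl⟩ := w'.exists_eq_decorate
    exact ⟨w, X, rfl, (key w X).1 hw'⟩
  · rintro ⟨w, X, rfl, hX⟩
    exact (key w X).2 hX

end Main

theorem mainTheorem6 {A : Type*} [Finite A] (D : Type*) [Infinite D]
    {M : Type*} [Monoid M] [Finite M] :
    (∀ (h : FreeMonoid A →* M) (ψ : EMSO2 A (recognizedFamily h)),
      ∃ 𝒜 : SetAutomaton A, 𝒜.IsSuffixStoring D h ∧ 𝒜.language D = ψ.language D) ∧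
    (∀ (n : ℕ) (h : FreeMonoid (A × Set (Fin n)) →* M)
      (ψ : ExtEMSO2 A n (recognizedFamily h)),
      ∃ 𝒜 : SetAutomaton (A × Set (Fin n)),
        𝒜.IsSuffixStoring D h ∧ 𝒜.language D = ψ.matrixLanguage D ∧
        (𝒜.rename Prod.fst).IsQuasiNormal ∧
        (𝒜.rename Prod.fst).language D = ψ.language D) := by
  refine ⟨fun h ψ => ?_, fun n h ψ => ?_⟩
  -- Predicates that ignore the set variables are evaluated by `h` after forgetting the decoration.
  -- Projecting the letters then turns a suffix-storing automaton for this composite into one for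
  -- `h`.
  · obtain ⟨𝒜, h1, h2⟩ := ψ.matrix.exists_setAutomaton (D := D)
      (h.comp (FreeMonoid.map Prod.fst)) (fun w _ => w.str) (fun L hL => by
        obtain ⟨P, rfl⟩ := hL
        refine ⟨P, fun w X i j => ?_⟩
        rw [← w.decorate_str_map_fst X, ← List.map_take, ← List.map_drop]
        rfl) ψ.closed
    refine ⟨𝒜.rename Prod.fst, h1.rename _, ?_⟩
    rw [SetAutomaton.rename_language, h2]
    ext w
    constructor
    · rintro ⟨_, ⟨w, X, rfl, hX⟩, rfl⟩
      rw [w.map_decorate X]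
      exact ⟨X, hX⟩
    · rintro ⟨X, hX⟩
      exact ⟨_, ⟨w, X, rfl, hX⟩, DataWord.map_decorate w X⟩
  · obtain ⟨𝒜, h1, h2⟩ := ψ.matrix.exists_setAutomaton (D := D)
      h (fun w X => (w.decorate X).str) (fun L hL => by
        obtain ⟨P, rfl⟩ := hL
        exact ⟨P, fun w X i j => Iff.rfl⟩) ψ.closed
    refine ⟨𝒜, h1, h2, ?_, ?_⟩
    · obtain ⟨S, hS, -⟩ := h1
      exact ⟨S, SetAutomaton.rename_isQuasiNormalWith hS _⟩
    rw [SetAutomaton.rename_language, h2]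
    ext w
    constructor
    · rintro ⟨_, ⟨w, X, rfl, hX⟩, rfl⟩
      rw [w.map_decorate X]
      exact ⟨X, hX⟩
    · rintro ⟨X, hX⟩
      exact ⟨_, ⟨w, X, rfl, hX⟩, DataWord.map_decorate w X⟩
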